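/- By a plane graph we mean a finite connected directed graph (parallel edges and loops allowed) embedded in the plane $\mathbb{C}$: vertices are distinct points, each edge is a continuous arc from its source vertex to its target vertex, and edges are simple and meet one another and the vertices only at their endpoints. Its open faces are the connected components of the complement of the graph; the unbounded one is the exterior face and the bounded ones are the interior faces. Each edge has a face on its left and a face on its right, with respect to its direction and the orientation of the plane. A path is a directed path without repeated vertices. The exterior face is anchorable if the set of edges having it on their left and the set of edges having it on their right form non-empty directed paths $\mathrm{dom}$ and $\mathrm{cod}$ with a common source vertex and a common target vertex. An interior face $F$ is anchorable if the set of edges having $F$ on their right and the set of edges having $F$ on their left form non-empty directed paths $\mathrm{dom}_F$ and $\mathrm{cod}_F$ from a common source vertex $s_F$ to a common target vertex $t_F$ which are internally disjoint (no common edges and no common interior vertices). A pasting scheme $\mathcal{P}$ is a plane graph all of whose faces are anchorable and such that the source vertex $s_{\mathcal{P}}$ of the exterior face is the only vertex without incoming edges and the target vertex $t_{\mathcal{P}}$ of the exterior face is the only vertex without outgoing edges. Write $\mathrm{dom}_{\mathcal{P}}$ and $\mathrm{cod}_{\mathcal{P}}$ for the source and target paths of the exterior face. The atomic 2-cells of $\mathcal{P}$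 are its interior faces. **Corollary.** For any pasting scheme $\mathcal{P}$, the set of atomic 2-cells is finite and can be linearly ordered as $\alpha_1,\dots,\alpha_n$ ($n \ge 0$, each atomic 2-cell occurring exactly once), together with (possibly empty) paths of edges $p_i$ from $s_{\mathcal{P}}$ to $s_{\alpha_i}$ and $q_i$ from $t_{\alpha_i}$ to $t_{\mathcal{P}}$ for each $1 \le i \le n$, so that for each $1 \le i < n$ the concatenated paths $$p_i\cdot \mathrm{cod}_{\alpha_i}\cdot q_i \;=\; p_{i+1}\cdot \mathrm{dom}_{\alpha_{i+1}}\cdot q_{i+1}$$ are equal. Moreover, if $n \ge 1$, then $p_1\cdot\mathrm{dom}_{\alpha_1}\cdot q_1=\mathrm{dom}_{\mathcal{P}}$ and $p_n\cdot\mathrm{cod}_{\alpha_n}\cdot q_n=\mathrm{cod}_{\mathcal{P}}$, so that these data form a pasting scheme presentation of $\mathcal{P}$ in the sense of Johnson and Yau. -/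

import Mathlib

/-- A plane graph: a finite connected directed multigraph (parallel edges and loops are allowed)
embedded in the plane `ℂ`. Vertices are distinct points; an edge `e` is a continuous arc from its
source to its target; edges are simple and meet each other and the vertices only at their
endpoints. -/
structure PlaneGraph (V E : Type*) where
  src : E → V
  tgt : E → V
  finite_vertices : Finite V
  finite_edges : Finite E
  nonempty_vertices : Nonempty V
  /-- Any two vertices are joined by an undirected walk. -/
  connected : ∀ u v : V, Relation.EqvGen (fun a b => ∃ e, src e = a ∧ tgt e = b) u v
  pos : V → ℂ
  pos_injective : Function.Injective pos
  arc : E → C(unitInterval, ℂ)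
  arc_zero : ∀ e, arc e 0 = pos (src e)
  arc_one : ∀ e, arc e 1 = pos (tgt e)
  arc_ne_pos : ∀ (e : E) (t : unitInterval), 0 < t → t < 1 → ∀ v, arc e t ≠ pos v
  arc_injective : ∀ (e e' : E) (t t' : unitInterval), 0 < t → t < 1 → 0 < t' → t' < 1 →
    arc e t = arc e' t' → e = e' ∧ t = t'

/-- `SweepsAngle γ z a`: as seen from the point `z` (not on the curve `γ`), the curve `γ` sweeps out
the total signed (counterclockwise positive) angle `a`. That is, a continuous choice `θ t` of the
argument of `γ t - z` changes by `a` between `t = 0` and `t = 1`. -/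
def SweepsAngle (γ : C(unitInterval, ℂ)) (z : ℂ) (a : ℝ) : Prop :=
  ∃ θ : C(unitInterval, ℝ),
    (∀ t, γ t - z = (‖γ t - z‖ : ℂ) * Complex.exp ((θ t : ℂ) * Complex.I)) ∧ θ 1 - θ 0 = a

namespace PlaneGraph

variable {V E : Type*} (G : PlaneGraph V E)

/-- The subset of the plane occupied by the graph. -/
def support : Set ℂ := Set.range G.pos ∪ ⋃ e, Set.range (G.arc e)

/-- The open interior faces: the bounded connected components of the complement of the graph. -/
def InteriorFace : Type :=
  {F : Set ℂ // Bornology.IsBounded F ∧ ∃ z ∈ G.supportᶜ, F = connectedComponentIn G.supportᶜ z}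

/-- The open exterior face: the points of the complement of the graph that lie in its unbounded
component. -/
def exteriorFace : Set ℂ :=
  {z | z ∈ G.supportᶜ ∧ ¬ Bornology.IsBounded (connectedComponentIn G.supportᶜ z)}

/-- The open face `F` is incident to the edge `e` on the left of `e`. When a point crosses an
oriented arc at an interior point of the arc, the angle swept out by the arc as seen from that point
jumps by `2π`, and the larger value is the one on the left-hand side (for example, the segment from
`0` to `1` sweeps out nearly `π` from a point just above `1/2`, and nearly `-π` from one just below).
So `F` is on the left of `e` when, arbitrarily close to some interior point of `e`, there are points
`z` of `F` and `w` off the graph such that `e` sweeps out a larger angle from `z` than from `w`, the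
difference (which is near a multiple of `2π`) being more than `π`. -/
def OnLeft (F : Set ℂ) (e : E) : Prop :=
  ∃ t : unitInterval, 0 < t ∧ t < 1 ∧ ∀ ε : ℝ, 0 < ε →
    ∃ z ∈ F, ∃ w ∈ G.supportᶜ, dist z (G.arc e t) < ε ∧ dist w (G.arc e t) < ε ∧
      ∃ a b : ℝ, SweepsAngle (G.arc e) z a ∧ SweepsAngle (G.arc e) w b ∧ b + Real.pi < a

/-- The open face `F` is incident to the edge `e` on the right of `e`. -/
def OnRight (F : Set ℂ) (e : E) : Prop :=
  ∃ t : unitInterval, 0 < t ∧ t < 1 ∧ ∀ ε : ℝ, 0 < ε →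
    ∃ z ∈ F, ∃ w ∈ G.supportᶜ, dist z (G.arc e t) < ε ∧ dist w (G.arc e t) < ε ∧
      ∃ a b : ℝ, SweepsAngle (G.arc e) z a ∧ SweepsAngle (G.arc e) w b ∧ a + Real.pi < b

/-- `G.IsWalk x l y`: the list of edges `l` is composable, from `x` to `y`. -/
def IsWalk : V → List E → V → Prop
  | x, [], y => x = y
  | x, e :: l, y => G.src e = x ∧ IsWalk (G.tgt e) l y

/-- `G.IsPath x l y`: the list `l` of edges is a (possibly empty) directed path from `x` to `y`;
as usual, a path does not repeat vertices. -/
def IsPath (x : V) (l : List E) (y : V) : Prop :=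
  G.IsWalk x l y ∧ (x :: l.map G.tgt).Nodup

/-- The interior vertices of a directed path: the targets of all its edges but the last. -/
def interiorVertices (l : List E) : List V := l.dropLast.map G.tgt

/-- Two directed paths with common endpoints are internally disjoint. -/
def InternallyDisjoint (l l' : List E) : Prop :=
  l.Disjoint l' ∧ (G.interiorVertices l).Disjoint (G.interiorVertices l')

/-- `Anchor G A B`: the sets of edges `A` and `B` form non-empty directed paths `dom` and `cod` from
a common vertex `source` to a common vertex `target`. All of this data is determined by `A`, `B`. -/
structure Anchor (A B : Set E) where
  source : V
  target : V
  dom : List E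
  cod : List E
  dom_ne_nil : dom ≠ []
  cod_ne_nil : cod ≠ []
  dom_isPath : G.IsPath source dom target
  cod_isPath : G.IsPath source cod target
  mem_dom : ∀ e, e ∈ dom ↔ e ∈ A
  mem_cod : ∀ e, e ∈ cod ↔ e ∈ B

/-- A vertex incident to outgoing edges only. -/
def IsLocalSource (v : V) : Prop := ∀ e, G.tgt e ≠ v

/-- A vertex incident to incoming edges only. -/
def IsLocalSink (v : V) : Prop := ∀ e, G.src e ≠ v

end PlaneGraph

/-- A pasting scheme: a plane graph all of whose faces are anchorable, such that the source and the
target of the exterior face are its only local source and its only local sink. -/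
structure PastingScheme (V E : Type*) extends PlaneGraph V E where
  /-- The source path of the exterior face consists of the edges that have it on their left, the
  target path of those that have it on their right. -/
  exterior : toPlaneGraph.Anchor
    {e | toPlaneGraph.OnLeft toPlaneGraph.exteriorFace e}
    {e | toPlaneGraph.OnRight toPlaneGraph.exteriorFace e}
  /-- The source path of an interior face consists of the edges that have it on their right, the
  target path of those that have it on their left. -/
  interior : ∀ F : toPlaneGraph.InteriorFace, toPlaneGraph.Anchor
    {e | toPlaneGraph.OnRight F.1 e} {e | toPlaneGraph.OnLeft F.1 e}
  interior_disjoint : ∀ F, toPlaneGraph.InternallyDisjoint (interior F).dom (interior F).cod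
  isLocalSource_iff : ∀ v, toPlaneGraph.IsLocalSource v ↔ v = exterior.source
  isLocalSink_iff : ∀ v, toPlaneGraph.IsLocalSink v ↔ v = exterior.target

namespace PastingScheme

variable {V E : Type*} (P : PastingScheme V E)

/-- The atomic 2-cells of a pasting scheme are its interior faces. -/
abbrev TwoCell : Type := P.toPlaneGraph.InteriorFace

/-- The source vertex of the pasting scheme. -/
def s : V := P.exterior.source

/-- The target vertex of the pasting scheme. -/
def t : V := P.exterior.target

/-- The source path of the pasting scheme. -/
def dom : List E := P.exterior.dom

/-- The target path of the pasting scheme. -/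
def cod : List E := P.exterior.cod

/-- The source vertex of an atomic 2-cell. -/
def cellSource (α : P.TwoCell) : V := (P.interior α).source

/-- The target vertex of an atomic 2-cell. -/
def cellTarget (α : P.TwoCell) : V := (P.interior α).target

/-- The source path of an atomic 2-cell. -/
def cellDom (α : P.TwoCell) : List E := (P.interior α).dom

/-- The target path of an atomic 2-cell. -/
def cellCod (α : P.TwoCell) : List E := (P.interior α).cod

end PastingScheme

section PastingSchemeTopology

open Set Filter Topology

theorem IsPreconnected.eq_of_int_multiples {X : Type*} [TopologicalSpace X] {S : Set X}
    (hS : IsPreconnected S) {f : X → ℝ} (hf : ContinuousOn f S) {c : ℝ} (hc : c ≠ 0)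
    (h : ∀ x ∈ S, ∃ n : ℤ, f x = c * n) {x y : X} (hx : x ∈ S) (hy : y ∈ S) : f x = f y := by
  have hr : ∀ x ∈ S, f x = c * (round (f x / c) : ℤ) := by
    intro x hx
    obtain ⟨n, hn⟩ := h x hx
    rw [hn, mul_div_cancel_left₀ _ hc, round_intCast]
  have hc' : ContinuousOn (fun x => round (f x / c)) S := by
    rw [Int.isClosedEmbedding_coe_real.isInducing.continuousOn_iff]
    refine (hf.div_const c).congr fun x hx => ?_
    obtain ⟨n, hn⟩ := h x hx
    simp only [Function.comp_apply]
    rw [hn, mul_div_cancel_left₀ _ hc, round_intCast]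
  rw [hr x hx, hr y hy, hS.constant hc' hx hy]

theorem exists_continuousMap_exp_eq {A : Type*} [TopologicalSpace A] [SimplyConnectedSpace A]
    [LocallyPathConnectedSpace A] (f : C(A, ℂ)) (hf : ∀ a, f a ≠ 0) :
    ∃ g : C(A, ℂ), ∀ a, Complex.exp (g a) = f a := by
  obtain ⟨a₀⟩ : Nonempty A := inferInstance
  obtain ⟨F, ⟨-, hF⟩, -⟩ := Complex.isCoveringMapOn_exp.existsUnique_continuousMap_lifts f
    (Complex.exp_log (hf a₀)) hf
  exact ⟨F, fun a => congr_fun hF a⟩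

instance unitInterval.simplyConnectedSpace : SimplyConnectedSpace unitInterval :=
  have := (convex_Icc (0 : ℝ) 1).contractibleSpace ⟨0, by simp⟩
  SimplyConnectedSpace.ofContractible _

instance unitInterval.locallyPathConnectedSpace : LocallyPathConnectedSpace unitInterval :=
  (convex_Icc (0 : ℝ) 1).locallyPathConnectedSpace

theorem exists_log_unitInterval (f : C(unitInterval, ℂ)) (hf : ∀ t, f t ≠ 0) :
    ∃ g : C(unitInterval, ℂ), ∀ t, Complex.exp (g t) = f t :=
  exists_continuousMap_exp_eq f hf

theorem SweepsAngle.of_log {γ : C(unitInterval, ℂ)} {z : ℂ} (g : C(unitInterval, ℂ))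
    (hg : ∀ t, Complex.exp (g t) = γ t - z) : SweepsAngle γ z ((g 1).im - (g 0).im) := by
  refine ⟨⟨fun t => (g t).im, by fun_prop⟩, fun t => ?_, rfl⟩
  rw [← hg t, Complex.norm_exp]
  simp only [ContinuousMap.coe_mk]
  rw [Complex.ofReal_exp, ← Complex.exp_add, Complex.re_add_im]

theorem exists_log_sub {γ : C(unitInterval, ℂ)} {z : ℂ} (hz : z ∉ range γ) :
    ∃ g : C(unitInterval, ℂ), ∀ t, Complex.exp (g t) = γ t - z :=
  exists_log_unitInterval (γ - ContinuousMap.const _ z) fun t h => hz ⟨t, sub_eq_zero.1 h⟩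

theorem SweepsAngle.unique {γ : C(unitInterval, ℂ)} {z : ℂ} (hz : z ∉ range γ) {a b : ℝ}
    (ha : SweepsAngle γ z a) (hb : SweepsAngle γ z b) : a = b := by
  obtain ⟨θ, hθ, rfl⟩ := ha
  obtain ⟨φ, hφ, rfl⟩ := hb
  have hint : ∀ t ∈ (univ : Set unitInterval), ∃ n : ℤ, θ t - φ t = 2 * Real.pi * n := by
    intro t _
    have h0 : ((‖γ t - z‖ : ℝ) : ℂ) ≠ 0 := by
      rw [Complex.ofReal_ne_zero, norm_ne_zero_iff]
      exact fun h => hz ⟨t, sub_eq_zero.1 h⟩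
    have h1 := mul_left_cancel₀ h0 ((hθ t).symm.trans (hφ t))
    obtain ⟨n, hn⟩ := Complex.exp_eq_exp_iff_exists_int.1 h1
    refine ⟨n, ?_⟩
    have h2 : (θ t : ℂ) * Complex.I = ((φ t + n * (2 * Real.pi) : ℝ) : ℂ) * Complex.I := by
      rw [hn]; push_cast; ring
    have h3 := Complex.ofReal_injective (mul_right_cancel₀ Complex.I_ne_zero h2)
    rw [h3]; ring
  have := isPreconnected_univ.eq_of_int_multiples (f := fun t => θ t - φ t)
    (by fun_prop) (by positivity) hint (mem_univ 1) (mem_univ 0)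
  linarith

/-- The angle swept out by a curve as seen from a point off the curve. -/
noncomputable def sweep (γ : C(unitInterval, ℂ)) (z : ℂ) : ℝ :=
  open Classical in if h : ∃ a, SweepsAngle γ z a then h.choose else 0

theorem sweepsAngle_sweep {γ : C(unitInterval, ℂ)} {z : ℂ} (hz : z ∉ range γ) :
    SweepsAngle γ z (sweep γ z) := by
  obtain ⟨g, hg⟩ := exists_log_sub hz
  have h : ∃ a, SweepsAngle γ z a := ⟨_, .of_log g hg⟩
  rw [sweep, dif_pos h]
  exact h.choose_spec

theorem SweepsAngle.eq_sweep {γ : C(unitInterval, ℂ)} {z : ℂ} (hz : z ∉ range γ) {a : ℝ}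
    (h : SweepsAngle γ z a) : a = sweep γ z := h.unique hz (sweepsAngle_sweep hz)

theorem sweep_eq_of_log {γ : C(unitInterval, ℂ)} {z : ℂ} (g : C(unitInterval, ℂ))
    (hg : ∀ t, Complex.exp (g t) = γ t - z) : sweep γ z = (g 1).im - (g 0).im := by
  refine ((SweepsAngle.of_log g hg).eq_sweep ?_).symm
  rintro ⟨t, ht⟩
  exact Complex.exp_ne_zero (g t) (by rw [hg, ht, sub_self])

theorem Complex.exists_arg_exp (w : ℂ) : ∃ n : ℤ, w.im = (Complex.exp w).arg + 2 * Real.pi * n := by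
  have h : Complex.exp w = Complex.exp (Complex.log (Complex.exp w)) :=
    (Complex.exp_log (Complex.exp_ne_zero w)).symm
  obtain ⟨n, hn⟩ := Complex.exp_eq_exp_iff_exists_int.1 h
  refine ⟨n, ?_⟩
  have := congr_arg Complex.im hn
  simp [Complex.log_im] at this
  rw [this]; ring

theorem sweep_mod {γ : C(unitInterval, ℂ)} {z : ℂ} (hz : z ∉ range γ) :
    ∃ n : ℤ, sweep γ z = (γ 1 - z).arg - (γ 0 - z).arg + 2 * Real.pi * n := by
  obtain ⟨g, hg⟩ := exists_log_sub hz
  obtain ⟨n, hn⟩ := Complex.exists_arg_exp (g 1)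
  obtain ⟨m, hm⟩ := Complex.exists_arg_exp (g 0)
  rw [hg] at hn hm
  refine ⟨n - m, ?_⟩
  rw [sweep_eq_of_log g hg, hn, hm]
  push_cast; ring

theorem Complex.mem_slitPlane_of_norm_sub_lt {u : ℂ} (h : ‖u - 1‖ < 1) : u ∈ Complex.slitPlane := by
  have := Complex.mem_slitPlane_of_norm_lt_one h
  simpa using this

/-- When the base point moves by less than its distance to the curve, the swept angle changes by
principal arguments at the two ends. -/
theorem sweep_eq_add {γ : C(unitInterval, ℂ)} {z w : ℂ}
    (h : ∀ t, ‖z - w‖ < ‖γ t - z‖) : sweep γ w =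
      sweep γ z + (((γ 1 - w) / (γ 1 - z)).arg - ((γ 0 - w) / (γ 0 - z)).arg) := by
  have h0 : ∀ t, γ t - z ≠ 0 := fun t => norm_pos_iff.1 ((norm_nonneg _).trans_lt (h t))
  have hz : z ∉ range γ := by
    rintro ⟨t, ht⟩
    exact h0 t (by rw [ht, sub_self])
  have hs : ∀ t, (γ t - w) / (γ t - z) ∈ Complex.slitPlane := by
    intro t
    apply Complex.mem_slitPlane_of_norm_sub_lt
    have : (γ t - w) / (γ t - z) - 1 = (z - w) / (γ t - z) := by
      field_simp [h0 t]; ring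
    rw [this, norm_div, div_lt_one ((norm_nonneg _).trans_lt (h t))]
    exact h t
  obtain ⟨g, hg⟩ := exists_log_sub hz
  let k : C(unitInterval, ℂ) := ⟨fun t => g t + Complex.log ((γ t - w) / (γ t - z)), by
    refine g.continuous.add (Continuous.clog ?_ hs)
    exact Continuous.div (by fun_prop) (by fun_prop) h0⟩
  have hk : ∀ t, Complex.exp (k t) = γ t - w := by
    intro t
    simp only [k, ContinuousMap.coe_mk]
    rw [Complex.exp_add, hg, Complex.exp_log (Complex.slitPlane_ne_zero (hs t)),
      mul_div_cancel₀ _ (h0 t)]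
  rw [sweep_eq_of_log g hg, sweep_eq_of_log k hk]
  simp [k, Complex.log_im]
  ring

theorem exists_lt_norm_sub {γ : C(unitInterval, ℂ)} {z : ℂ} (hz : z ∉ range γ) :
    ∃ d > 0, ∀ t, d ≤ ‖γ t - z‖ := by
  have hc : IsClosed (range γ) := (isCompact_range γ.continuous).isClosed
  have hp := (hc.notMem_iff_infDist_pos ⟨_, mem_range_self 0⟩).1 hz
  refine ⟨_, hp, fun t => ?_⟩
  rw [← dist_eq_norm, dist_comm]
  exact Metric.infDist_le_dist_of_mem (mem_range_self t)

theorem continuousAt_sweep {γ : C(unitInterval, ℂ)} {z : ℂ} (hz : z ∉ range γ) :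
    ContinuousAt (sweep γ) z := by
  obtain ⟨d, hd, hdle⟩ := exists_lt_norm_sub hz
  have h0 : ∀ t, γ t - z ≠ 0 := fun t => norm_pos_iff.1 (hd.trans_le (hdle t))
  have hev : sweep γ =ᶠ[𝓝 z] fun w =>
      sweep γ z + (((γ 1 - w) / (γ 1 - z)).arg - ((γ 0 - w) / (γ 0 - z)).arg) := by
    filter_upwards [Metric.ball_mem_nhds z hd] with w hw
    refine sweep_eq_add fun t => lt_of_lt_of_le ?_ (hdle t)
    rwa [← dist_eq_norm, dist_comm]
  refine ContinuousAt.congr ?_ hev.symm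
  have ha : ∀ t, ContinuousAt (fun w => ((γ t - w) / (γ t - z)).arg) z := fun t => by
    refine ContinuousAt.comp (g := Complex.arg) ?_ (by fun_prop)
    rw [div_self (h0 t)]
    exact Complex.continuousAt_arg Complex.one_mem_slitPlane
  exact continuousAt_const.add ((ha 1).sub (ha 0))

theorem sweep_far {γ : C(unitInterval, ℂ)} {z : ℂ} (h : ∀ t, ‖γ t‖ < ‖z‖) :
    sweep γ z = (1 - γ 1 / z).arg - (1 - γ 0 / z).arg := by
  have hz : 0 < ‖z‖ := (norm_nonneg _).trans_lt (h 0)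
  have hz0 : z ≠ 0 := norm_pos_iff.1 hz
  have hs : ∀ t, 1 - γ t / z ∈ Complex.slitPlane := by
    intro t
    apply Complex.mem_slitPlane_of_norm_sub_lt
    rw [sub_sub_cancel_left, norm_neg, norm_div, div_lt_one hz]
    exact h t
  let k : C(unitInterval, ℂ) := ⟨fun t => Complex.log (-z) + Complex.log (1 - γ t / z),
    continuous_const.add (Continuous.clog (by fun_prop) hs)⟩
  have hk : ∀ t, Complex.exp (k t) = γ t - z := by
    intro t
    simp only [k, ContinuousMap.coe_mk]
    rw [Complex.exp_add, Complex.exp_log (neg_ne_zero.2 hz0),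
      Complex.exp_log (Complex.slitPlane_ne_zero (hs t))]
    field_simp
    ring
  rw [sweep_eq_of_log k hk]
  simp [k, Complex.log_im]

/-- The total angle swept out by an integral combination of curves. -/
noncomputable def chainSweep {ι : Type*} [Fintype ι] (f : ι → ℤ) (γ : ι → C(unitInterval, ℂ))
    (z : ℂ) : ℝ := ∑ i, f i * sweep (γ i) z

/-- An integral combination of curves without boundary. -/
def IsClosedChain {ι : Type*} [Fintype ι] (f : ι → ℤ) (γ : ι → C(unitInterval, ℂ)) : Prop :=
  ∀ φ : ℂ → ℝ, ∑ i, (f i : ℝ) * (φ (γ i 1) - φ (γ i 0)) = 0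

section chain

variable {ι : Type*} [Fintype ι] {f : ι → ℤ} {γ : ι → C(unitInterval, ℂ)}

theorem continuousAt_chainSweep {z : ℂ} (hz : ∀ i, f i ≠ 0 → z ∉ range (γ i)) :
    ContinuousAt (chainSweep f γ) z := by
  refine tendsto_finsetSum _ fun i _ => ?_
  by_cases hi : f i = 0
  · simp [hi]
  · exact (continuousAt_sweep (hz i hi)).const_mul _

theorem IsClosedChain.chainSweep_int (h : IsClosedChain f γ) {z : ℂ}
    (hz : ∀ i, f i ≠ 0 → z ∉ range (γ i)) : ∃ n : ℤ, chainSweep f γ z = 2 * Real.pi * n := by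
  have : ∀ i, ∃ n : ℤ, (f i : ℝ) * sweep (γ i) z =
      f i * ((γ i 1 - z).arg - (γ i 0 - z).arg) + 2 * Real.pi * n := by
    intro i
    by_cases hi : f i = 0
    · exact ⟨0, by simp [hi]⟩
    · obtain ⟨n, hn⟩ := sweep_mod (hz i hi)
      exact ⟨f i * n, by rw [hn]; push_cast; ring⟩
  choose n hn using this
  refine ⟨∑ i, n i, ?_⟩
  rw [chainSweep, Finset.sum_congr rfl fun i _ => hn i, Finset.sum_add_distrib,
    h fun w => (w - z).arg, zero_add, Int.cast_sum, Finset.mul_sum]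

theorem IsClosedChain.exists_chainSweep_eq_zero (h : IsClosedChain f γ) :
    ∃ R : ℝ, ∀ z : ℂ, R < ‖z‖ → chainSweep f γ z = 0 := by
  have : ∀ i, ∃ R : ℝ, ∀ t, ‖γ i t‖ ≤ R := fun i => by
    obtain ⟨R, hR⟩ := (isCompact_range (γ i).continuous).isBounded.exists_norm_le
    exact ⟨R, fun t => hR _ (mem_range_self t)⟩
  choose R hR using this
  obtain ⟨M, hM⟩ := (Set.finite_range R).bddAbove
  refine ⟨M, fun z hz => ?_⟩
  rw [chainSweep, ← h fun w => (1 - w / z).arg]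
  refine Finset.sum_congr rfl fun i _ => ?_
  rw [sweep_far fun t => (hR i t).trans_lt ((hM (mem_range_self i)).trans_lt hz)]

theorem IsClosedChain.chainSweep_eq (h : IsClosedChain f γ) {S : Set ℂ} (hS : IsPreconnected S)
    (hd : ∀ z ∈ S, ∀ i, f i ≠ 0 → z ∉ range (γ i)) {z w : ℂ} (hz : z ∈ S) (hw : w ∈ S) :
    chainSweep f γ z = chainSweep f γ w :=
  hS.eq_of_int_multiples (c := 2 * Real.pi)
    (fun z hz => (continuousAt_chainSweep (hd z hz)).continuousWithinAt) (by positivity)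
    (fun z hz => h.chainSweep_int (hd z hz)) hz hw

theorem exists_norm_gt_of_not_isBounded {S : Set ℂ} (hS : ¬ Bornology.IsBounded S) (R : ℝ) :
    ∃ z ∈ S, R < ‖z‖ := by
  by_contra! hcon
  exact hS (isBounded_iff_forall_norm_le.2 ⟨R, hcon⟩)

theorem IsClosedChain.chainSweep_eq_zero (h : IsClosedChain f γ) {S : Set ℂ}
    (hS : IsPreconnected S) (hd : ∀ z ∈ S, ∀ i, f i ≠ 0 → z ∉ range (γ i))
    (hb : ¬ Bornology.IsBounded S) {z : ℂ} (hz : z ∈ S) : chainSweep f γ z = 0 := by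
  obtain ⟨R, hR⟩ := h.exists_chainSweep_eq_zero
  obtain ⟨w, hw, hRw⟩ := exists_norm_gt_of_not_isBounded hb R
  rw [h.chainSweep_eq hS hd hz hw, hR w hRw]

end chain

theorem false_of_eq_sub_of_lt_norm {f : C(ℂ, ℂ)} (hf : ∀ ζ, f ζ ≠ 0) {z : ℂ} {R : ℝ}
    (hR : ∀ ζ, R < ‖ζ‖ → f ζ = ζ - z) : False := by
  obtain ⟨g, hg⟩ := exists_continuousMap_exp_eq f hf
  set ρ : ℝ := |R| + ‖z‖ + 1 with hρ
  have hρ0 : 0 < ρ := by positivity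
  let c : ℝ → ℂ := fun s => z + ρ * Complex.exp (s * Complex.I)
  have hc : Continuous c := by fun_prop
  have hcn : ∀ s, R < ‖c s‖ := by
    intro s
    have h1 : ‖(ρ : ℂ) * Complex.exp (s * Complex.I)‖ = ρ := by
      rw [norm_mul, Complex.norm_exp_ofReal_mul_I, mul_one, Complex.norm_real, Real.norm_eq_abs,
        abs_of_pos hρ0]
    have h2 : ‖(ρ : ℂ) * Complex.exp (s * Complex.I)‖ ≤ ‖c s‖ + ‖z‖ := by
      have : (ρ : ℂ) * Complex.exp (s * Complex.I) = c s - z := by simp [c]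
      rw [this]; exact norm_sub_le _ _
    have := le_abs_self R
    linarith
  have hint : ∀ s ∈ (univ : Set ℝ), ∃ n : ℤ, (g (c s)).im - s = 2 * Real.pi * n := by
    intro s _
    have h1 : Complex.exp (g (c s)) = Complex.exp (Real.log ρ + s * Complex.I) := by
      rw [hg, hR _ (hcn s), Complex.exp_add, ← Complex.ofReal_exp, Real.exp_log hρ0]
      simp [c]
    obtain ⟨n, hn⟩ := Complex.exp_eq_exp_iff_exists_int.1 h1
    refine ⟨n, ?_⟩
    have := congr_arg Complex.im hn
    simp at this
    rw [this]; ring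
  have h := isPreconnected_univ.eq_of_int_multiples (f := fun s => (g (c s)).im - s)
    (by fun_prop) (by positivity) hint (mem_univ 0) (mem_univ (2 * Real.pi))
  have hcc : c (2 * Real.pi) = c 0 := by simp [c]
  simp only [hcc] at h
  have := Real.pi_pos
  linarith

theorem closure_connectedComponentIn_inter_subset {F : Set ℂ} {z : ℂ} (hF : IsOpen F) :
    closure (connectedComponentIn F z) ∩ F ⊆ connectedComponentIn F z := by
  rintro y ⟨hy, hyF⟩
  obtain ⟨x, hx, hxz⟩ := mem_closure_iff.1 hy _ hF.connectedComponentIn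
    (mem_connectedComponentIn hyF)
  rw [connectedComponentIn_eq hxz, ← connectedComponentIn_eq hx]
  exact mem_connectedComponentIn hyF

/-- A criterion of Eilenberg: if `ζ - z` has a continuous logarithm on the compact set `K` relative
to a function without zeros on `K` and on the component of `z`, then `z` is in an unbounded
component of the complement of `K`. -/
theorem IsCompact.not_isBounded_connectedComponentIn_compl {K : Set ℂ} (hK : IsCompact K) {z : ℂ}
    (hz : z ∉ K) {h : ℂ → ℂ} (hc : Continuous h)
    (h0 : ∀ ζ ∈ K ∪ connectedComponentIn Kᶜ z, h ζ ≠ 0) {g : ℂ → ℂ} (hg : ContinuousOn g K)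
    (hgh : ∀ ζ ∈ K, Complex.exp (g ζ) * h ζ = ζ - z) :
    ¬ Bornology.IsBounded (connectedComponentIn Kᶜ z) := by
  intro hb
  have hKo : IsOpen Kᶜ := hK.isClosed.isOpen_compl
  set U := connectedComponentIn Kᶜ z with hU
  have hUo : IsOpen U := hKo.connectedComponentIn
  have hzU : z ∈ U := mem_connectedComponentIn hz
  obtain ⟨G, hG⟩ := ContinuousMap.exists_restrict_eq hK.isClosed
    ⟨K.domRestrict g, continuousOn_iff_continuous_domRestrict.1 hg⟩
  have hG' : ∀ ζ ∈ K, G ζ = g ζ := fun ζ hζ => by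
    simpa using DFunLike.congr_fun hG ⟨ζ, hζ⟩
  classical
  let f : ℂ → ℂ := U.piecewise (fun ζ => Complex.exp (G ζ) * h ζ) fun ζ => ζ - z
  have hf : Continuous f := by
    refine Continuous.piecewise (fun ζ hζ => ?_) (by fun_prop) (by fun_prop)
    have hζK : ζ ∈ K := by
      by_contra hn
      rw [hUo.frontier_eq] at hζ
      exact hζ.2 (closure_connectedComponentIn_inter_subset hKo ⟨hζ.1, hn⟩)
    rw [hG' ζ hζK, hgh ζ hζK]
  obtain ⟨R, hR⟩ := hb.exists_norm_le
  refine false_of_eq_sub_of_lt_norm (f := ⟨f, hf⟩) (z := z) (R := R) (fun ζ => ?_) fun ζ hζ => ?_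
  · by_cases hζ : ζ ∈ U
    · simp only [f, ContinuousMap.coe_mk, piecewise_eq_of_mem _ _ _ hζ]
      exact mul_ne_zero (Complex.exp_ne_zero _) (h0 ζ (Or.inr hζ))
    · simp only [f, ContinuousMap.coe_mk, piecewise_eq_of_notMem _ _ _ hζ]
      exact fun he => hζ (by rwa [sub_eq_zero.1 he])
  · have : ζ ∉ U := fun hm => (hR ζ hm).not_gt hζ
    simp only [f, ContinuousMap.coe_mk, piecewise_eq_of_notMem _ _ _ this]

theorem IsCompact.connectedComponentIn_compl_eq_or {K : Set ℂ} (hK : IsCompact K) {z z' : ℂ}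
    (hz : z ∉ K) (hz' : z' ∉ K) {g : ℂ → ℂ} (hg : ContinuousOn g K)
    (h : ∀ ζ ∈ K, Complex.exp (g ζ) * (ζ - z') = ζ - z) :
    connectedComponentIn Kᶜ z = connectedComponentIn Kᶜ z' ∨
      ¬ Bornology.IsBounded (connectedComponentIn Kᶜ z) ∧
      ¬ Bornology.IsBounded (connectedComponentIn Kᶜ z') := by
  by_cases heq : connectedComponentIn Kᶜ z = connectedComponentIn Kᶜ z'
  · exact Or.inl heq
  refine Or.inr ⟨?_, ?_⟩
  · refine hK.not_isBounded_connectedComponentIn_compl hz (h := fun ζ => ζ - z') (by fun_prop)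
      ?_ hg h
    rintro ζ (hζ | hζ) h0 <;> rw [sub_eq_zero.1 h0] at hζ
    exacts [hz' hζ, heq (connectedComponentIn_eq hζ)]
  · refine hK.not_isBounded_connectedComponentIn_compl hz' (h := fun ζ => ζ - z) (by fun_prop)
      ?_ hg.neg ?_
    · rintro ζ (hζ | hζ) h0 <;> rw [sub_eq_zero.1 h0] at hζ
      exacts [hz hζ, heq (connectedComponentIn_eq hζ).symm]
    · intro ζ hζ
      simp only [Pi.neg_apply]
      rw [← h ζ hζ, ← mul_assoc, ← Complex.exp_add, neg_add_cancel, Complex.exp_zero, one_mul]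

theorem exists_continuousOn_union {X Y : Type*} [TopologicalSpace X] [TopologicalSpace Y]
    {K L : Set X} (hK : IsClosed K) (hL : IsClosed L) {f g : X → Y} (hf : ContinuousOn f K)
    (hg : ContinuousOn g L) (hfg : ∀ x ∈ K, x ∈ L → f x = g x) :
    ∃ k : X → Y, ContinuousOn k (K ∪ L) ∧ EqOn k f K ∧ EqOn k g L := by
  classical
  have h1 : EqOn (K.piecewise f g) f K := fun x hx => piecewise_eq_of_mem _ _ _ hx
  have h2 : EqOn (K.piecewise f g) g L := fun x hx => by
    by_cases hxK : x ∈ K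
    · rw [piecewise_eq_of_mem _ _ _ hxK, hfg x hxK hx]
    · rw [piecewise_eq_of_notMem _ _ _ hxK]
  exact ⟨K.piecewise f g, (hf.congr h1).union_of_isClosed (hg.congr h2) hK hL, h1, h2⟩

theorem exists_continuousOn_range {X : Type*} [TopologicalSpace X] [CompactSpace X]
    {γ ℓ : C(X, ℂ)} (h : ∀ t t', γ t = γ t' → ℓ t = ℓ t') :
    ∃ g : ℂ → ℂ, ContinuousOn g (range γ) ∧ ∀ t, g (γ t) = ℓ t := by
  classical
  let g : ℂ → ℂ := fun y => if hy : y ∈ range γ then ℓ hy.choose else 0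
  have hg : ∀ t, g (γ t) = ℓ t := fun t => by
    have ht : γ t ∈ range γ := mem_range_self t
    simp only [g, dif_pos ht]
    exact h _ _ ht.choose_spec
  refine ⟨g, ?_, hg⟩
  rw [continuousOn_iff_continuous_domRestrict]
  have hq : IsQuotientMap (rangeFactorization γ) :=
    (γ.continuous.rangeFactorization.isClosedMap).isQuotientMap γ.continuous.rangeFactorization
      rangeFactorization_surjective
  rw [hq.continuous_iff]
  convert ℓ.continuous using 1
  ext t
  exact hg t

/-- Every continuous function without zeros on the set has a continuous logarithm. -/
def HasLogs (K : Set ℂ) : Prop :=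
  ∀ f : ℂ → ℂ, ContinuousOn f K → (∀ ζ ∈ K, f ζ ≠ 0) →
    ∃ g : ℂ → ℂ, ContinuousOn g K ∧ ∀ ζ ∈ K, Complex.exp (g ζ) = f ζ

theorem hasLogs_range {γ : C(unitInterval, ℂ)} (hγ : Function.Injective γ) :
    HasLogs (range γ) := by
  intro f hf h0
  obtain ⟨ℓ, hℓ⟩ := exists_log_unitInterval
    ⟨f ∘ γ, hf.comp_continuous γ.continuous fun t => mem_range_self t⟩
    fun t => h0 _ (mem_range_self t)
  obtain ⟨g, hg, hgℓ⟩ := exists_continuousOn_range (γ := γ) (ℓ := ℓ) fun t t' h => by rw [hγ h]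
  refine ⟨g, hg, ?_⟩
  rintro _ ⟨t, rfl⟩
  rw [hgℓ, hℓ]; rfl

theorem HasLogs.union {K L : Set ℂ} (hK : HasLogs K) (hL : HasLogs L) (hKc : IsClosed K)
    (hLc : IsClosed L) (hs : (K ∩ L).Subsingleton) : HasLogs (K ∪ L) := by
  intro f hf h0
  obtain ⟨g, hg, hgf⟩ := hK f (hf.mono subset_union_left) fun ζ hζ => h0 ζ (Or.inl hζ)
  obtain ⟨k, hk, hkf⟩ := hL f (hf.mono subset_union_right) fun ζ hζ => h0 ζ (Or.inr hζ)
  obtain ⟨c, hc, hcx⟩ : ∃ c : ℂ, Complex.exp c = 1 ∧ ∀ x ∈ K, x ∈ L → g x = k x + c := by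
    by_cases hne : (K ∩ L).Nonempty
    · obtain ⟨y, hyK, hyL⟩ := hne
      refine ⟨g y - k y, ?_, fun x hxK hxL => ?_⟩
      · rw [Complex.exp_sub, hgf y hyK, hkf y hyL, div_self (h0 y (Or.inl hyK))]
      · rw [hs ⟨hxK, hxL⟩ ⟨hyK, hyL⟩]; ring
    · exact ⟨0, by simp, fun x hxK hxL => absurd ⟨x, hxK, hxL⟩ hne⟩
  obtain ⟨m, hm, hmg, hmk⟩ := exists_continuousOn_union hKc hLc hg
    (hk.add (continuousOn_const (c := c))) hcx
  refine ⟨m, hm, ?_⟩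
  rintro ζ (hζ | hζ)
  · rw [hmg hζ, hgf ζ hζ]
  · rw [hmk hζ, Pi.add_apply, Complex.exp_add, hkf ζ hζ, hc, mul_one]

theorem HasLogs.not_isBounded {K : Set ℂ} (h : HasLogs K) (hK : IsCompact K) {z : ℂ} (hz : z ∉ K) :
    ¬ Bornology.IsBounded (connectedComponentIn Kᶜ z) := by
  obtain ⟨g, hg, hgz⟩ := h (fun ζ => ζ - z) (by fun_prop) fun ζ hζ h0 =>
    hz (by rwa [← sub_eq_zero.1 h0])
  exact hK.not_isBounded_connectedComponentIn_compl hz (h := fun _ => 1) continuous_const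
    (fun _ _ => one_ne_zero) hg fun ζ hζ => by rw [hgz ζ hζ, mul_one]

theorem Complex.abs_arg_lt_of_norm_sub_lt {u : ℂ} (h : ‖u - 1‖ < 1) :
    |u.arg| < Real.pi / 2 := by
  rw [Complex.abs_arg_lt_pi_div_two_iff]
  left
  have := (Complex.abs_re_le_norm (u - 1)).trans_lt h
  rw [Complex.sub_re, Complex.one_re, abs_lt] at this
  linarith

theorem Complex.norm_sub_div_sub_lt {ζ z z' : ℂ} (h : ‖z - z'‖ < ‖ζ - z'‖) :
    ‖(ζ - z) / (ζ - z') - 1‖ < 1 := by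
  have h0 : 0 < ‖ζ - z'‖ := (norm_nonneg _).trans_lt h
  have : (ζ - z) / (ζ - z') - 1 = -((z - z') / (ζ - z')) := by
    rw [div_sub_one (norm_pos_iff.1 h0), ← neg_div]; ring
  rwa [this, norm_neg, norm_div, div_lt_one h0]

/-- Two points close to an arc and far from the rest of a compact set are not separated by that set
if they see the arc under almost the same angle. -/
theorem connectedComponentIn_compl_union_range {γ : C(unitInterval, ℂ)} {K : Set ℂ}
    (hK : IsCompact K) (hγ : ∀ t t', γ t = γ t' → t = t' ∨ t = 0 ∧ t' = 1 ∨ t = 1 ∧ t' = 0)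
    (h0K : γ 0 ∈ K) (h1K : γ 1 ∈ K) (hKγ : ∀ t, γ t ∈ K → t = 0 ∨ t = 1) {z z' : ℂ}
    (hz : z ∉ range γ) (hz' : z' ∉ range γ) (hfar : ∀ ζ ∈ K, ‖z - z'‖ < ‖ζ - z'‖) (hzK : z ∉ K)
    (hs : |sweep γ z - sweep γ z'| < Real.pi) :
    connectedComponentIn (K ∪ range γ)ᶜ z = connectedComponentIn (K ∪ range γ)ᶜ z' ∨
      ¬ Bornology.IsBounded (connectedComponentIn (K ∪ range γ)ᶜ z) ∧
      ¬ Bornology.IsBounded (connectedComponentIn (K ∪ range γ)ᶜ z') := by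
  have hz'K : z' ∉ K := fun h => by
    have := hfar z' h
    simp only [sub_self, norm_zero] at this
    exact absurd this (norm_nonneg _).not_gt
  have hne' : ∀ ζ ∈ K, ζ - z' ≠ 0 := fun ζ hζ h => hz'K (by rwa [← sub_eq_zero.1 h])
  have hsmall : ∀ ζ ∈ K, ‖(ζ - z) / (ζ - z') - 1‖ < 1 := fun ζ hζ =>
    Complex.norm_sub_div_sub_lt (hfar ζ hζ)
  obtain ⟨a, ha⟩ := exists_log_sub hz
  obtain ⟨b, hb⟩ := exists_log_sub hz'
  have hγz' : ∀ t, γ t - z' ≠ 0 := fun t h => hz' ⟨t, sub_eq_zero.1 h⟩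
  have hab : ∀ t, Complex.exp (a t - b t) = (γ t - z) / (γ t - z') := fun t => by
    rw [Complex.exp_sub, ha, hb]
  have hlog : ∀ t, γ t ∈ K → ∃ n : ℤ, a t - b t =
      Complex.log ((γ t - z) / (γ t - z')) + n * (2 * Real.pi * Complex.I) := fun t ht => by
    rw [← Complex.exp_eq_exp_iff_exists_int, hab, Complex.exp_log]
    exact Complex.slitPlane_ne_zero (Complex.mem_slitPlane_of_norm_sub_lt (hsmall _ ht))
  obtain ⟨n, hn⟩ := hlog 0 h0K
  obtain ⟨m, hm⟩ := hlog 1 h1K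
  have hnm : m = n := by
    have e0 := congr_arg Complex.im hn
    have e1 := congr_arg Complex.im hm
    simp [Complex.log_im] at e0 e1
    rw [sweep_eq_of_log a ha, sweep_eq_of_log b hb] at hs
    have a0 := abs_lt.1 (Complex.abs_arg_lt_of_norm_sub_lt (hsmall _ h0K))
    have a1 := abs_lt.1 (Complex.abs_arg_lt_of_norm_sub_lt (hsmall _ h1K))
    have hs' := abs_lt.1 hs
    have hlt : |((m - n : ℤ) : ℝ) * (2 * Real.pi)| < 1 * (2 * Real.pi) := by
      push_cast
      rw [abs_lt]; constructor <;> linarith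
    rw [abs_mul, abs_of_pos (by positivity : 0 < 2 * Real.pi)] at hlt
    have h1 := lt_of_mul_lt_mul_right hlt (by positivity)
    have h2 : |m - n| < 1 := by exact_mod_cast h1
    have := Int.abs_lt_one_iff.1 h2
    omega
  let ℓ : C(unitInterval, ℂ) := ⟨fun t => a t - b t - n * (2 * Real.pi * Complex.I), by fun_prop⟩
  have hℓ : ∀ t, γ t ∈ K → ℓ t = Complex.log ((γ t - z) / (γ t - z')) := by
    intro t ht
    rcases hKγ t ht with rfl | rfl
    · simp only [ℓ, ContinuousMap.coe_mk, hn]; ring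
    · simp only [ℓ, ContinuousMap.coe_mk, hm, hnm]; ring
  have hℓe : ∀ t, Complex.exp (ℓ t) = (γ t - z) / (γ t - z') := by
    intro t
    simp only [ℓ, ContinuousMap.coe_mk]
    rw [Complex.exp_sub, Complex.exp_int_mul_two_pi_mul_I, div_one, hab]
  obtain ⟨g, hg, hgℓ⟩ := exists_continuousOn_range (γ := γ) (ℓ := ℓ) fun t t' h => by
    rcases hγ t t' h with rfl | ⟨rfl, rfl⟩ | ⟨rfl, rfl⟩
    · rfl
    · rw [hℓ 0 h0K, hℓ 1 h1K, h]
    · rw [hℓ 0 h0K, hℓ 1 h1K, h]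
  obtain ⟨k, hk, hk1, hk2⟩ := exists_continuousOn_union hK.isClosed
    (isCompact_range γ.continuous).isClosed
    (f := fun ζ => Complex.log ((ζ - z) / (ζ - z'))) (g := g)
    (ContinuousOn.clog (by fun_prop (disch := assumption))
      fun ζ hζ => Complex.mem_slitPlane_of_norm_sub_lt (hsmall ζ hζ)) hg (by
      rintro _ hζ ⟨t, rfl⟩
      rw [hgℓ, hℓ t hζ])
  refine (hK.union (isCompact_range γ.continuous)).connectedComponentIn_compl_eq_or
    (by simp_all) (by simp_all) hk ?_
  rintro ζ (hζ | ⟨t, rfl⟩)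
  · rw [hk1 hζ, Complex.exp_log (Complex.slitPlane_ne_zero
      (Complex.mem_slitPlane_of_norm_sub_lt (hsmall ζ hζ))), div_mul_cancel₀ _ (hne' ζ hζ)]
  · rw [hk2 ⟨t, rfl⟩, hgℓ, hℓe, div_mul_cancel₀ _ (hγz' t)]

/-- The affine reparametrization of the unit interval from `a` to `b`. -/
noncomputable def unitInterval.segmentMap (a b : unitInterval) : C(unitInterval, unitInterval) where
  toFun t := ⟨(1 - t) * a + t * b, by
    have ha := a.2; have hb := b.2; have ht := t.2
    exact convex_Icc (0 : ℝ) 1 ha hb (by linarith [ht.2]) ht.1 (by ring)⟩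
  continuous_toFun := by fun_prop

/-- The piece of a curve between the times `a` and `b`. -/
noncomputable def subarc (γ : C(unitInterval, ℂ)) (a b : unitInterval) : C(unitInterval, ℂ) :=
  γ.comp (unitInterval.segmentMap a b)

theorem unitInterval.segmentMap_zero (a b : unitInterval) : segmentMap a b 0 = a :=
  Subtype.ext (by simp [segmentMap])

theorem unitInterval.segmentMap_one (a b : unitInterval) : segmentMap a b 1 = b :=
  Subtype.ext (by simp [segmentMap])

theorem unitInterval.range_segmentMap {a b : unitInterval} (h : a ≤ b) :
    range (segmentMap a b) = Icc a b := by
  refine Subset.antisymm ?_ fun t ht => ?_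
  · rintro _ ⟨t, rfl⟩
    have h' : (a : ℝ) ≤ b := h
    have ht := t.2
    constructor <;> rw [← Subtype.coe_le_coe] <;> simp only [segmentMap, ContinuousMap.coe_mk] <;>
      nlinarith [ht.1, ht.2]
  · have := intermediate_value_Icc (zero_le_one : (0 : unitInterval) ≤ 1)
      (segmentMap a b).continuous.continuousOn
    rw [segmentMap_zero, segmentMap_one] at this
    obtain ⟨s, -, hs⟩ := this ht
    exact ⟨s, hs⟩

theorem unitInterval.segmentMap_injective {a b : unitInterval} (h : a < b) :
    Function.Injective (segmentMap a b) := by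
  intro s t hst
  have h' : (a : ℝ) < b := h
  have := congr_arg Subtype.val hst
  simp only [segmentMap, ContinuousMap.coe_mk] at this
  have h2 : ((s : ℝ) - t) * (b - a) = 0 := by linarith
  rcases mul_eq_zero.1 h2 with h3 | h3
  · exact Subtype.ext (by linarith)
  · linarith

theorem subarc_zero (γ : C(unitInterval, ℂ)) (a b : unitInterval) : subarc γ a b 0 = γ a := by
  simp [subarc, unitInterval.segmentMap_zero]

theorem subarc_one (γ : C(unitInterval, ℂ)) (a b : unitInterval) : subarc γ a b 1 = γ b := by
  simp [subarc, unitInterval.segmentMap_one]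

theorem range_subarc (γ : C(unitInterval, ℂ)) {a b : unitInterval} (h : a ≤ b) :
    range (subarc γ a b) = γ '' Icc a b := by
  rw [subarc, ContinuousMap.coe_comp, range_comp, unitInterval.range_segmentMap h]

theorem range_subarc_subset (γ : C(unitInterval, ℂ)) (a b : unitInterval) :
    range (subarc γ a b) ⊆ range γ := range_comp_subset_range (unitInterval.segmentMap a b) γ

theorem subarc_injective {γ : C(unitInterval, ℂ)} {a b : unitInterval} (h : a < b)
    (hγ : InjOn γ (Icc a b)) : Function.Injective (subarc γ a b) := by
  intro s t hst
  refine unitInterval.segmentMap_injective h (hγ ?_ ?_ hst) <;>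
    exact unitInterval.range_segmentMap h.le ▸ mem_range_self _

theorem sweep_eq_add_subarc {γ : C(unitInterval, ℂ)} {z : ℂ} (hz : z ∉ range γ)
    (a b : unitInterval) : sweep γ z =
      sweep (subarc γ 0 a) z + sweep (subarc γ a b) z + sweep (subarc γ b 1) z := by
  obtain ⟨g, hg⟩ := exists_log_sub hz
  have h : ∀ a b, sweep (subarc γ a b) z = (g b).im - (g a).im := fun a b => by
    rw [sweep_eq_of_log (g.comp (unitInterval.segmentMap a b)) fun t => hg _]
    simp [unitInterval.segmentMap_zero, unitInterval.segmentMap_one]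
  rw [h, h, h, sweep_eq_of_log g hg]
  ring

theorem unitInterval.exists_Icc_subset {U : Set unitInterval} (hU : IsOpen U) {t : unitInterval}
    (ht : t ∈ U) (h0 : 0 < t) (h1 : t < 1) :
    ∃ a b, 0 < a ∧ a < t ∧ t < b ∧ b < 1 ∧ Icc a b ⊆ U := by
  obtain ⟨a, hat, ha⟩ := exists_Ioc_subset_of_mem_nhds (hU.mem_nhds ht) ⟨0, h0⟩
  obtain ⟨b, htb, hb⟩ := exists_Ico_subset_of_mem_nhds (hU.mem_nhds ht) ⟨1, h1⟩
  obtain ⟨a', ha'1, ha'2⟩ := exists_between hat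
  obtain ⟨b', hb'1, hb'2⟩ := exists_between htb
  refine ⟨a', b', lt_of_le_of_lt a.2.1 ha'1, ha'2, hb'1, lt_of_lt_of_le hb'2 b.2.2, ?_⟩
  intro s hs
  rcases le_total s t with h | h
  · exact ha ⟨ha'1.trans_le hs.1, h⟩
  · exact hb ⟨h, hs.2.trans_lt hb'2⟩

theorem eq_of_abs_sub_lt_of_int_multiples {x y : ℝ} (hx : ∃ n : ℤ, x = 2 * Real.pi * n)
    (hy : ∃ n : ℤ, y = 2 * Real.pi * n) (h : |x - y| < 2 * Real.pi) : x = y := by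
  obtain ⟨n, rfl⟩ := hx
  obtain ⟨m, rfl⟩ := hy
  have h0 : 0 < 2 * Real.pi := by positivity
  rw [← mul_sub, abs_mul, abs_of_pos h0] at h
  have h1 : |(n : ℝ) - m| < 1 := lt_of_mul_lt_mul_left (by linarith) h0.le
  have h2 : |n - m| < 1 := by exact_mod_cast h1
  have h3 := Int.abs_lt_one_iff.1 h2
  rw [sub_eq_zero.1 h3]

theorem one_le_two_pi : (1 : ℝ) < 2 * Real.pi := by
  have := Real.pi_gt_three; linarith

section crosscut

variable {σ κ κ' : C(unitInterval, ℂ)} {f f' : Fin 2 → ℤ}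

theorem continuousAt_chainSweep_pair {z : ℂ} (h1 : z ∉ range σ) (h2 : z ∉ range κ) :
    ContinuousAt (chainSweep f ![σ, κ]) z :=
  continuousAt_chainSweep fun i _ => by fin_cases i <;> assumption

theorem IsClosedChain.pair_int (h : IsClosedChain f ![σ, κ]) {z : ℂ} (h1 : z ∉ range σ)
    (h2 : z ∉ range κ) : ∃ n : ℤ, chainSweep f ![σ, κ] z = 2 * Real.pi * n :=
  h.chainSweep_int fun i _ => by fin_cases i <;> assumption

/-- A closed curve composed of two arcs winds zero times around points arbitrarily close to any
interior point of the first arc. -/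
theorem exists_chainSweep_eq_zero_near (h : IsClosedChain f ![σ, κ]) (hσ : Function.Injective σ)
    (hκ : Function.Injective κ) (hd : ∀ t, σ t ∈ range κ → t = 0 ∨ t = 1) {τ : unitInterval}
    (h0 : 0 < τ) (h1 : τ < 1) {ε : ℝ} (hε : 0 < ε) :
    ∃ z ∈ Metric.ball (σ τ) ε, z ∉ range σ ∧ z ∉ range κ ∧ chainSweep f ![σ, κ] z = 0 := by
  by_contra! hcon
  set W := chainSweep f ![σ, κ] with hW
  obtain ⟨a, b, ha0, haτ, hτb, hb1, hab⟩ := unitInterval.exists_Icc_subset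
    (Metric.isOpen_ball.preimage σ.continuous) (Metric.mem_ball_self hε) h0 h1
  have hA : range (subarc σ 0 a) = σ '' Icc 0 a := range_subarc _ ha0.le
  have hB : range (subarc σ b 1) = σ '' Icc b 1 := range_subarc _ hb1.le
  have hAc := isCompact_range (subarc σ 0 a).continuous
  have hBc := isCompact_range (subarc σ b 1).continuous
  have hκc := isCompact_range κ.continuous
  set K := range (subarc σ 0 a) ∪ (range (subarc σ b 1) ∪ range κ) with hK
  have hKc : IsCompact K := hAc.union (hBc.union hκc)
  have hlogs : HasLogs K := by
    refine (hasLogs_range (subarc_injective ha0 hσ.injOn)).union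
      ((hasLogs_range (subarc_injective hb1 hσ.injOn)).union (hasLogs_range hκ) hBc.isClosed
        hκc.isClosed ?_) hAc.isClosed (hBc.union hκc).isClosed ?_
    · have : ∀ x ∈ range (subarc σ b 1) ∩ range κ, x = σ 1 := by
        rintro x ⟨hx, hxκ⟩
        rw [hB] at hx
        obtain ⟨t, ht, rfl⟩ := hx
        rcases hd t hxκ with rfl | rfl
        · exact absurd (ht.1.trans_lt' (h0.trans hτb)) (lt_irrefl _)
        · rfl
      exact fun x hx y hy => (this x hx).trans (this y hy).symm
    · have : ∀ x ∈ range (subarc σ 0 a) ∩ (range (subarc σ b 1) ∪ range κ), x = σ 0 := by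
        rintro x ⟨hx, hx'⟩
        rw [hA] at hx
        obtain ⟨t, ht, rfl⟩ := hx
        rcases hx' with hx' | hx'
        · rw [hB] at hx'
          obtain ⟨s, hs, hst⟩ := hx'
          rw [hσ hst] at hs
          exact absurd ((hs.1.trans ht.2).trans_lt (haτ.trans hτb)) (lt_irrefl _)
        · rcases hd t hx' with rfl | rfl
          · rfl
          · exact absurd (ht.2.trans_lt (haτ.trans h1)) (lt_irrefl _)
      exact fun x hx y hy => (this x hx).trans (this y hy).symm
  have hxK : σ τ ∉ K := by
    rintro (hx | hx | hx)
    · rw [hA] at hx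
      obtain ⟨s, hs, hst⟩ := hx
      rw [hσ hst] at hs
      exact absurd (hs.2.trans_lt haτ) (lt_irrefl _)
    · rw [hB] at hx
      obtain ⟨s, hs, hst⟩ := hx
      rw [hσ hst] at hs
      exact absurd (hs.1.trans_lt' hτb) (lt_irrefl _)
    · rcases hd τ hx with rfl | rfl
      exacts [lt_irrefl _ h0, lt_irrefl _ h1]
  set J := range σ ∪ range κ with hJ
  have hJc : IsClosed J := ((isCompact_range σ.continuous).union hκc).isClosed
  have hWc : ContinuousOn W Jᶜ := fun z hz =>
    (continuousAt_chainSweep_pair (fun h => hz (Or.inl h)) fun h => hz (Or.inr h)).continuousWithinAt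
  have hWi : ∀ z, z ∉ J → ∃ n : ℤ, W z = 2 * Real.pi * n := fun z hz =>
    h.pair_int (fun h => hz (Or.inl h)) fun h => hz (Or.inr h)
  have hu := hWc.isOpen_inter_preimage hJc.isOpen_compl (isOpen_compl_singleton (x := (0 : ℝ)))
  have hv := hWc.isOpen_inter_preimage hJc.isOpen_compl (isOpen_Ioo (a := (-1 : ℝ)) (b := 1))
  have hvW : ∀ z ∈ Jᶜ ∩ W ⁻¹' Ioo (-1) 1, W z = 0 := fun z hz => by
    refine eq_of_abs_sub_lt_of_int_multiples (hWi z hz.1) ⟨0, by simp⟩ ?_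
    rw [sub_zero]
    exact (abs_lt.2 hz.2).trans one_le_two_pi
  have hsub := isPreconnected_connectedComponentIn (F := Kᶜ) (x := σ τ) |>.subset_left_of_subset_union
    (Metric.isOpen_ball (x := σ τ) (ε := ε) |>.union hu) hv (by
      rw [Set.disjoint_left]
      rintro z (hz | hz) hz'
      · exact hcon z hz (fun h => hz'.1 (Or.inl h)) (fun h => hz'.1 (Or.inr h)) (hvW z hz')
      · exact hz.2 (hvW z hz')) (by
      intro z hz
      have hzK : z ∉ K := connectedComponentIn_subset _ _ hz
      by_cases hzJ : z ∈ J
      · refine Or.inl (Or.inl ?_)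
        rcases hzJ with ⟨t, rfl⟩ | hzκ
        · refine hab ⟨?_, ?_⟩ <;> by_contra! hlt
          · exact hzK (Or.inl (hA ▸ mem_image_of_mem _ ⟨t.2.1, hlt.le⟩))
          · exact hzK (Or.inr (Or.inl (hB ▸ mem_image_of_mem _ ⟨hlt.le, t.2.2⟩)))
        · exact absurd (Or.inr (Or.inr hzκ)) hzK
      · by_cases hz0 : W z = 0
        · exact Or.inr ⟨hzJ, by simp [hz0]⟩
        · exact Or.inl (Or.inr ⟨hzJ, hz0⟩))
    ⟨σ τ, mem_connectedComponentIn hxK, Or.inl (Metric.mem_ball_self hε)⟩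
  obtain ⟨R, hR⟩ := h.exists_chainSweep_eq_zero
  obtain ⟨w, hw, hRw⟩ := exists_norm_gt_of_not_isBounded (hlogs.not_isBounded hKc hxK)
    (max R (‖σ τ‖ + ε))
  rcases hsub hw with hwb | hwu
  · rw [Metric.mem_ball, dist_eq_norm] at hwb
    have h2 : ‖w‖ ≤ ‖w - σ τ‖ + ‖σ τ‖ := by simpa using norm_add_le (w - σ τ) (σ τ)
    have := (le_max_right R (‖σ τ‖ + ε)).trans_lt hRw
    linarith
  · exact hwu.2 (hR w ((le_max_left _ _).trans_lt hRw))

theorem IsClosedChain.pair_eq_zero_of_mem_sphere (h : IsClosedChain f ![σ, κ]) {x y : ℂ} {r : ℝ}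
    (hr : 0 < r) (hσr : range σ ⊆ Metric.closedBall x r) (hκr : range κ ⊆ Metric.closedBall x r)
    (hy : y ∈ Metric.sphere x r) (h1 : y ∉ range σ) (h2 : y ∉ range κ) :
    chainSweep f ![σ, κ] y = 0 := by
  have hy' : ‖y - x‖ = r := by rwa [mem_sphere_iff_norm] at hy
  let ρ : ℝ → ℂ := fun s => x + s * (y - x)
  have hρn : ∀ s, 0 ≤ s → dist (ρ s) x = s * r := fun s hs => by
    rw [dist_eq_norm]
    simp only [ρ, add_sub_cancel_left, norm_mul, Complex.norm_real, hy', Real.norm_eq_abs,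
      abs_of_nonneg hs]
  refine h.chainSweep_eq_zero (S := ρ '' Ici 1) (isPreconnected_Ici.image _ (by fun_prop)) ?_ ?_
    ⟨1, mem_Ici.2 le_rfl, by simp [ρ]⟩
  · rintro _ ⟨s, hs, rfl⟩ i -
    have : ρ s ∉ range σ ∧ ρ s ∉ range κ := by
      rcases eq_or_lt_of_le (mem_Ici.1 hs) with rfl | hs'
      · have : ρ 1 = y := by simp [ρ]
        rw [this]; exact ⟨h1, h2⟩
      · have : ρ s ∉ Metric.closedBall x r := by
          rw [Metric.mem_closedBall, hρn s (by linarith), not_le]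
          nlinarith
        exact ⟨fun hm => this (hσr hm), fun hm => this (hκr hm)⟩
    fin_cases i
    exacts [this.1, this.2]
  · intro hb
    obtain ⟨R, hR⟩ := (Metric.isBounded_iff_subset_closedBall x).1 hb
    have h3 := hR (mem_image_of_mem ρ (mem_Ici.2 (le_max_left 1 (R / r + 1))))
    rw [Metric.mem_closedBall, hρn _ (by positivity)] at h3
    have h4 := mul_le_mul_of_nonneg_right (le_max_right 1 (R / r + 1)) hr.le
    rw [add_mul, div_mul_cancel₀ _ hr.ne'] at h4
    linarith

/-- A crosscut of a disc, closed up along either of the two arcs of the circle, winds zero times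
around each point of the disc for one of the two choices. -/
theorem crosscut_chainSweep_eq_zero_or (h : IsClosedChain f ![σ, κ])
    (h' : IsClosedChain f' ![σ, κ']) (hσ : Function.Injective σ) {x : ℂ} {r : ℝ} (hr : 0 < r)
    (hσr : range σ ⊆ Metric.closedBall x r) (hκr : range κ ⊆ Metric.sphere x r)
    (hκ'r : range κ' ⊆ Metric.sphere x r) (hκκ' : range κ ∩ range κ' ⊆ range σ)
    {z : ℂ} (hz : z ∈ Metric.ball x r) (hzσ : z ∉ range σ) :
    chainSweep f ![σ, κ] z = 0 ∨ chainSweep f' ![σ, κ'] z = 0 := by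
  by_contra! hcon
  set W := chainSweep f ![σ, κ] with hW
  set W' := chainSweep f' ![σ, κ'] with hW'
  have hσc : IsClosed (range σ) := (isCompact_range σ.continuous).isClosed
  have hball : ∀ {y}, y ∈ Metric.ball x r → ∀ {k : C(unitInterval, ℂ)},
      range k ⊆ Metric.sphere x r → y ∉ range k := fun hy k hk hm =>
    (Metric.sphere_disjoint_ball.ne_of_mem (hk hm) hy) rfl
  set D := Metric.ball x r ∩ (range σ)ᶜ with hD
  have hDo : IsOpen D := Metric.isOpen_ball.inter hσc.isOpen_compl
  have hWD : ContinuousOn W D := fun y hy =>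
    (continuousAt_chainSweep_pair hy.2 (hball hy.1 hκr)).continuousWithinAt
  have hWD' : ContinuousOn W' D := fun y hy =>
    (continuousAt_chainSweep_pair hy.2 (hball hy.1 hκ'r)).continuousWithinAt
  set u := D ∩ (fun y => (W y, W' y)) ⁻¹' (Metric.ball (W z) 1 ×ˢ Metric.ball (W' z) 1) with hu
  have huo : IsOpen u := (hWD.prodMk hWD').isOpen_inter_preimage hDo
    (Metric.isOpen_ball.prod Metric.isOpen_ball)
  have hclose : ∀ {V : ℂ → ℝ} {y : ℂ}, y ∈ closure u → ContinuousAt V y →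
      (∀ y ∈ u, dist (V y) (V z) < 1) → |V y - V z| ≤ 1 := by
    intro V y hy hV hVu
    rw [← Real.dist_eq, ← Metric.mem_closedBall]
    exact Metric.isClosed_closedBall.closure_subset
      (closure_mono (by
        rintro _ ⟨w, hw, rfl⟩
        exact Metric.mem_closedBall.2 (hVu w hw).le)
        (hV.continuousWithinAt.mem_closure_image hy))
  have hWu : ∀ y ∈ u, dist (W y) (W z) < 1 := fun y hy => hy.2.1
  have hWu' : ∀ y ∈ u, dist (W' y) (W' z) < 1 := fun y hy => hy.2.2
  have hzi := h.pair_int hzσ (hball hz hκr)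
  have hzi' := h'.pair_int hzσ (hball hz hκ'r)
  have hsub : connectedComponentIn (range σ)ᶜ z ⊆ u := by
    refine isPreconnected_connectedComponentIn.subset_of_closure_inter_subset huo
      ⟨z, mem_connectedComponentIn hzσ, ⟨hz, hzσ⟩, by simp⟩ ?_
    rintro y ⟨hy, hyC⟩
    have hyσ : y ∉ range σ := connectedComponentIn_subset _ _ hyC
    have hyr : y ∈ Metric.closedBall x r := Metric.closure_ball_subset_closedBall
      (closure_mono (fun w hw => hw.1.1) hy)
    rcases eq_or_lt_of_le (Metric.mem_closedBall.1 hyr) with hys | hyb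
    · have hy2 : y ∉ range κ ∨ y ∉ range κ' := by
        by_contra! h2
        exact hyσ (hκκ' h2)
      rcases hy2 with hyκ | hyκ
      · have h1 := hclose hy (continuousAt_chainSweep_pair hyσ hyκ) hWu
        have h2 := eq_of_abs_sub_lt_of_int_multiples (h.pair_int hyσ hyκ) hzi
          (h1.trans_lt one_le_two_pi)
        exact absurd (h2.symm.trans (h.pair_eq_zero_of_mem_sphere hr hσr
          (hκr.trans Metric.sphere_subset_closedBall) hys hyσ hyκ)) hcon.1
      · have h1 := hclose hy (continuousAt_chainSweep_pair hyσ hyκ) hWu'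
        have h2 := eq_of_abs_sub_lt_of_int_multiples (h'.pair_int hyσ hyκ) hzi'
          (h1.trans_lt one_le_two_pi)
        exact absurd (h2.symm.trans (h'.pair_eq_zero_of_mem_sphere hr hσr
          (hκ'r.trans Metric.sphere_subset_closedBall) hys hyσ hyκ)) hcon.2
    · have hyb' : y ∈ Metric.ball x r := hyb
      have hc := continuousAt_chainSweep_pair (f := f) hyσ (hball hyb' hκr)
      have hc' := continuousAt_chainSweep_pair (f := f') hyσ (hball hyb' hκ'r)
      have h1 := eq_of_abs_sub_lt_of_int_multiples (h.pair_int hyσ (hball hyb' hκr)) hzi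
          ((hclose hy hc hWu).trans_lt one_le_two_pi)
      have h2 := eq_of_abs_sub_lt_of_int_multiples (h'.pair_int hyσ (hball hyb' hκ'r)) hzi'
          ((hclose hy hc' hWu').trans_lt one_le_two_pi)
      refine ⟨⟨hyb', hyσ⟩, ?_⟩
      simp only [mem_preimage, mem_prod, Metric.mem_ball]
      rw [hW, hW', h1, h2]
      simp
  exact (hasLogs_range hσ).not_isBounded (isCompact_range σ.continuous) hzσ
    ((Metric.isBounded_ball (x := x) (r := r)).subset fun y hy => (hsub hy).1.1)

end crosscut

/-- The arc of the circle of centre `x` and radius `r` between the angles `a` and `b`. -/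
noncomputable def circleArc (x : ℂ) (r a b : ℝ) : C(unitInterval, ℂ) where
  toFun t := x + r * Complex.exp (((1 - t) * a + t * b : ℝ) * Complex.I)
  continuous_toFun := by fun_prop

theorem circleArc_zero (x : ℂ) (r a b : ℝ) :
    circleArc x r a b 0 = x + r * Complex.exp (a * Complex.I) := by simp [circleArc]

theorem circleArc_one (x : ℂ) (r a b : ℝ) :
    circleArc x r a b 1 = x + r * Complex.exp (b * Complex.I) := by simp [circleArc]

theorem range_circleArc_subset (x : ℂ) {r : ℝ} (hr : 0 < r) (a b : ℝ) :
    range (circleArc x r a b) ⊆ Metric.sphere x r := by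
  rintro _ ⟨t, rfl⟩
  simp only [circleArc, ContinuousMap.coe_mk, mem_sphere_iff_norm, add_sub_cancel_left, norm_mul,
    Complex.norm_exp_ofReal_mul_I, mul_one, Complex.norm_real, Real.norm_eq_abs, abs_of_pos hr]

theorem exists_int_of_circle_eq {x : ℂ} {r : ℝ} (hr : 0 < r) {θ φ : ℝ}
    (h : x + r * Complex.exp (θ * Complex.I) = x + r * Complex.exp (φ * Complex.I)) :
    ∃ n : ℤ, θ - φ = n * (2 * Real.pi) := by
  have h1 := mul_left_cancel₀ (Complex.ofReal_ne_zero.2 hr.ne') (add_left_cancel h)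
  obtain ⟨n, hn⟩ := Complex.exp_eq_exp_iff_exists_int.1 h1
  refine ⟨n, ?_⟩
  have := congr_arg Complex.im hn
  simp at this
  linarith

theorem circleArc_injective (x : ℂ) {r : ℝ} (hr : 0 < r) {a b : ℝ} (hab : a < b)
    (hab' : b < a + 2 * Real.pi) : Function.Injective (circleArc x r a b) := by
  intro s t hst
  obtain ⟨n, hn⟩ := exists_int_of_circle_eq hr hst
  have hs := s.2; have ht := t.2
  have hn' : ((t : ℝ) - s) * (a - b) = n * (2 * Real.pi) := by linarith
  have hlt : |(n : ℝ) * (2 * Real.pi)| < 1 * (2 * Real.pi) := by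
    rw [← hn', abs_mul]
    have h1 : |(t : ℝ) - s| ≤ 1 := abs_le.2 ⟨by linarith [ht.1, hs.2], by linarith [ht.2, hs.1]⟩
    have h2 : |a - b| < 2 * Real.pi := abs_lt.2 ⟨by linarith, by linarith⟩
    exact mul_lt_mul' h1 h2 (abs_nonneg _) one_pos |>.trans_le' le_rfl
  rw [abs_mul, abs_of_pos (by positivity : 0 < 2 * Real.pi)] at hlt
  have h1 : |(n : ℝ)| < 1 := lt_of_mul_lt_mul_right hlt (by positivity)
  have h2 : |n| < 1 := by exact_mod_cast h1
  rw [Int.abs_lt_one_iff.1 h2, Int.cast_zero, zero_mul] at hn'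
  rcases mul_eq_zero.1 hn' with h3 | h3
  · exact Subtype.ext (by linarith)
  · linarith

theorem circleArc_eq_circleArc {x : ℂ} {r : ℝ} (hr : 0 < r) {a b : ℝ} (hba : b < a)
    (hab : a < b + 2 * Real.pi) {s t : unitInterval}
    (h : circleArc x r b a s = circleArc x r a (b + 2 * Real.pi) t) : s = 0 ∨ s = 1 := by
  obtain ⟨n, hn⟩ := exists_int_of_circle_eq hr h
  have hs := s.2; have ht := t.2
  have hpi := Real.pi_pos
  by_contra! hcon
  have hs0 : (0 : ℝ) < s := lt_of_le_of_ne hs.1 fun h => hcon.1 (Subtype.ext h.symm)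
  have hs1 : (s : ℝ) < 1 := lt_of_le_of_ne hs.2 fun h => hcon.2 (Subtype.ext h)
  have hA : 0 < (1 - (s : ℝ)) * (a - b) := mul_pos (by linarith) (by linarith)
  have hA' : 0 < (s : ℝ) * (a - b) := mul_pos hs0 (by linarith)
  have hB : 0 ≤ (t : ℝ) * (b + 2 * Real.pi - a) := mul_nonneg ht.1 (by linarith)
  have hB' : 0 ≤ (1 - (t : ℝ)) * (b + 2 * Real.pi - a) := mul_nonneg (by linarith [ht.2]) (by linarith)
  have h1 : (n : ℝ) * (2 * Real.pi) < 0 * (2 * Real.pi) := by linarith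
  have h2 : (-1 : ℝ) * (2 * Real.pi) < n * (2 * Real.pi) := by linarith
  have h3 := lt_of_mul_lt_mul_right h1 (by positivity)
  have h4 := lt_of_mul_lt_mul_right h2 (by positivity)
  have h5 : n < 0 := by exact_mod_cast h3
  have h6 : -1 < n := by exact_mod_cast h4
  omega

theorem sweep_circleArc_center (x : ℂ) {r : ℝ} (hr : 0 < r) (a b : ℝ) :
    sweep (circleArc x r a b) x = b - a := by
  rw [sweep_eq_of_log ⟨fun t : unitInterval =>
    (Real.log r : ℂ) + ((1 - t) * a + t * b : ℝ) * Complex.I, by fun_prop⟩]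
  · simp
  · intro t
    simp only [ContinuousMap.coe_mk, circleArc, add_sub_cancel_left]
    rw [Complex.exp_add, ← Complex.ofReal_exp, Real.exp_log hr]

theorem sweep_circleArc_add {x : ℂ} {r : ℝ} (hr : 0 < r) (a b : ℝ) {z : ℂ}
    (hz : z ∈ Metric.ball x r) :
    sweep (circleArc x r b a) z + sweep (circleArc x r a (b + 2 * Real.pi)) z = 2 * Real.pi := by
  have hc : IsClosedChain ![1, 1] ![circleArc x r b a, circleArc x r a (b + 2 * Real.pi)] := by
    intro φ
    simp [Fin.sum_univ_two, circleArc_zero, circleArc_one, add_mul, Complex.exp_add]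
  have h := hc.chainSweep_eq (Metric.isPreconnected_ball (x := x) (r := r)) (fun w hw i _ => by
    have : ∀ a b, w ∉ range (circleArc x r a b) := fun a b hm =>
      (Metric.sphere_disjoint_ball.ne_of_mem (range_circleArc_subset x hr a b hm) hw) rfl
    fin_cases i <;> exact this _ _) hz (Metric.mem_ball_self hr)
  simp only [chainSweep, Fin.sum_univ_two, Matrix.cons_val_zero, Matrix.cons_val_one, Int.cast_one,
    one_mul, sweep_circleArc_center x hr] at h
  rw [h]; ring

theorem exists_angle {x p : ℂ} {r : ℝ} (hp : p ∈ Metric.sphere x r) :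
    ∃ a ∈ Ioc (-Real.pi) Real.pi, p = x + r * Complex.exp (a * Complex.I) := by
  refine ⟨(p - x).arg, Complex.arg_mem_Ioc _, ?_⟩
  have h := Complex.norm_mul_exp_arg_mul_I (p - x)
  rw [mem_sphere_iff_norm.1 hp] at h
  rw [h]; ring

theorem exists_angles {x p q : ℂ} {r : ℝ} (hp : p ∈ Metric.sphere x r)
    (hq : q ∈ Metric.sphere x r) (hpq : p ≠ q) : ∃ a b : ℝ, b < a ∧ a < b + 2 * Real.pi ∧
      p = x + r * Complex.exp (a * Complex.I) ∧ q = x + r * Complex.exp (b * Complex.I) := by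
  obtain ⟨a, ha, hpa⟩ := exists_angle hp
  obtain ⟨b, hb, hqb⟩ := exists_angle hq
  rcases lt_trichotomy b a with h | h | h
  · exact ⟨a, b, h, by linarith [ha.2, hb.1], hpa, hqb⟩
  · exact absurd (by rw [hpa, hqb, h]) hpq
  · refine ⟨a, b - 2 * Real.pi, by linarith [ha.1, hb.2], by linarith, hpa, ?_⟩
    rw [hqb]
    push_cast
    rw [sub_mul, Complex.exp_sub, Complex.exp_two_pi_mul_I, div_one]

theorem exists_first_exit {γ : C(unitInterval, ℂ)} {t₀ : unitInterval} {r : ℝ} (hr : 0 < r)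
    (h1 : r < ‖γ 1 - γ t₀‖) :
    ∃ b, t₀ < b ∧ b < 1 ∧ ‖γ b - γ t₀‖ = r ∧ ∀ t, t₀ ≤ t → t < b → ‖γ t - γ t₀‖ < r := by
  have hN : Continuous fun t => ‖γ t - γ t₀‖ := by fun_prop
  have hS : IsCompact (Icc t₀ 1 ∩ {t | ‖γ t - γ t₀‖ = r}) :=
    isCompact_Icc.inter_right (isClosed_eq hN continuous_const)
  have hivt : ∀ t, t₀ ≤ t → r ≤ ‖γ t - γ t₀‖ → ∃ s ∈ Icc t₀ t, ‖γ s - γ t₀‖ = r := by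
    intro t ht hrt
    exact intermediate_value_Icc ht hN.continuousOn ⟨by simp [hr.le], hrt⟩
  obtain ⟨s, hs, hsr⟩ := hivt 1 t₀.2.2 h1.le
  obtain ⟨b, ⟨hb, hbr⟩, hmin⟩ := hS.exists_isLeast ⟨s, hs, hsr⟩
  refine ⟨b, lt_of_le_of_ne hb.1 ?_, lt_of_le_of_ne hb.2 ?_, hbr, fun t ht htb => ?_⟩
  · rintro rfl; simp at hbr; exact hr.ne hbr
  · rintro rfl; exact h1.ne' hbr
  · by_contra! hcon
    obtain ⟨s, hs, hsr⟩ := hivt t ht hcon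
    exact absurd ((hmin ⟨⟨hs.1, hs.2.trans t.2.2⟩, hsr⟩).trans hs.2) htb.not_ge

theorem exists_last_entry {γ : C(unitInterval, ℂ)} {t₀ : unitInterval} {r : ℝ} (hr : 0 < r)
    (h0 : r < ‖γ 0 - γ t₀‖) :
    ∃ a, 0 < a ∧ a < t₀ ∧ ‖γ a - γ t₀‖ = r ∧ ∀ t, a < t → t ≤ t₀ → ‖γ t - γ t₀‖ < r := by
  let σ : C(unitInterval, unitInterval) := ⟨unitInterval.symm, unitInterval.continuous_symm⟩
  obtain ⟨b, h1, h2, h3, h4⟩ := exists_first_exit (γ := γ.comp σ) (t₀ := unitInterval.symm t₀) hr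
    (by simpa [σ] using h0)
  refine ⟨unitInterval.symm b, ?_, ?_, by simpa [σ] using h3, fun t ht ht' => ?_⟩
  · rw [← unitInterval.symm_one]; exact unitInterval.symm_lt_symm.2 h2
  · rw [← unitInterval.symm_symm t₀]; exact unitInterval.symm_lt_symm.2 h1
  · have := h4 (unitInterval.symm t) (unitInterval.symm_le_symm.2 ht') (by
      rw [← unitInterval.symm_symm b]; exact unitInterval.symm_lt_symm.2 ht)
    simpa [σ] using this

/-- A curve which is simple, except possibly for the coincidence of its endpoints. -/
def IsSimpleArc (γ : C(unitInterval, ℂ)) : Prop :=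
  ∀ t t', γ t = γ t' → t = t' ∨ t = 0 ∧ t' = 1 ∨ t = 1 ∧ t' = 0

/-- Near an interior point of a simple arc, the angle under which the arc is seen takes exactly two
values, up to a continuous correction, and the two values differ by a full turn. -/
theorem IsSimpleArc.exists_local_sweep {γ : C(unitInterval, ℂ)} (hγ : IsSimpleArc γ)
    {t₀ : unitInterval} (h0 : 0 < t₀) (h1 : t₀ < 1) :
    ∃ β : ℂ → ℝ, ContinuousAt β (γ t₀) ∧
      (∀ᶠ z in 𝓝 (γ t₀), z ∉ range γ → sweep γ z = β z ∨ sweep γ z = β z + 2 * Real.pi) ∧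
      (∃ᶠ z in 𝓝 (γ t₀), z ∉ range γ ∧ sweep γ z = β z) ∧
      (∃ᶠ z in 𝓝 (γ t₀), z ∉ range γ ∧ sweep γ z = β z + 2 * Real.pi) := by
  set x := γ t₀ with hx
  have hinj : ∀ t, γ t = x → t = t₀ := by
    intro t ht
    rcases hγ t t₀ ht with h | ⟨-, h⟩ | ⟨-, h⟩
    · exact h
    · exact absurd h h1.ne
    · exact absurd h h0.ne'
  have hpos : ∀ t, t ≠ t₀ → 0 < ‖γ t - x‖ := fun t ht =>
    norm_pos_iff.2 fun h => ht (hinj t (sub_eq_zero.1 h))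
  obtain ⟨r, hr, hrm⟩ := exists_between (lt_min (hpos 0 h0.ne) (hpos 1 h1.ne'))
  obtain ⟨hr0, hr1⟩ := lt_min_iff.1 hrm
  obtain ⟨a, ha0, hat, har, hain⟩ := exists_last_entry hr hr0
  obtain ⟨b, htb, hb1, hbr, hbin⟩ := exists_first_exit hr hr1
  have hab : a < b := hat.trans htb
  set σ := subarc γ a b with hσ
  have hinjab : InjOn γ (Icc a b) := by
    intro s hs t ht hst
    rcases hγ s t hst with h | ⟨rfl, -⟩ | ⟨rfl, -⟩
    · exact h
    · exact absurd (ha0.trans_le hs.1) (lt_irrefl _)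
    · exact absurd (hb1.trans_le' hs.2) (lt_irrefl _)
  have hσi : Function.Injective σ := subarc_injective hab hinjab
  have hσr : range σ ⊆ Metric.closedBall x r := by
    rw [hσ, range_subarc _ hab.le]
    rintro _ ⟨t, ht, rfl⟩
    rw [mem_closedBall_iff_norm]
    rcases le_total t t₀ with h | h
    · rcases eq_or_lt_of_le ht.1 with rfl | h'
      exacts [har.le, (hain t h' h).le]
    · rcases eq_or_lt_of_le ht.2 with rfl | h'
      exacts [hbr.le, (hbin t h h').le]
  have hsph : ∀ s, σ s ∈ Metric.sphere x r → s = 0 ∨ s = 1 := by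
    intro s hs
    have hm : unitInterval.segmentMap a b s ∈ Icc a b :=
      unitInterval.range_segmentMap hab.le ▸ mem_range_self s
    have hs' : ‖γ (unitInterval.segmentMap a b s) - x‖ = r := mem_sphere_iff_norm.1 hs
    rcases eq_or_lt_of_le hm.1 with h | h
    · left
      apply unitInterval.segmentMap_injective hab
      rw [← h, unitInterval.segmentMap_zero]
    · rcases eq_or_lt_of_le hm.2 with h' | h'
      · right
        apply unitInterval.segmentMap_injective hab
        rw [h', unitInterval.segmentMap_one]
      · rcases le_total (unitInterval.segmentMap a b s) t₀ with h2 | h2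
        · exact absurd hs' (hain _ h h2).ne
        · exact absurd hs' (hbin _ h2 h').ne
  have hpq : γ a ≠ γ b := fun h =>
    hab.ne (hinjab ⟨le_rfl, hab.le⟩ ⟨hab.le, le_rfl⟩ h)
  obtain ⟨A, B, hBA, hAB, hpA, hqB⟩ := exists_angles (mem_sphere_iff_norm.2 har)
    (mem_sphere_iff_norm.2 hbr) hpq
  set κ := circleArc x r B A with hκ
  set κ' := circleArc x r A (B + 2 * Real.pi) with hκ'
  have hσ0 : σ 0 = x + r * Complex.exp (A * Complex.I) := by rw [hσ, subarc_zero, hpA]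
  have hσ1 : σ 1 = x + r * Complex.exp (B * Complex.I) := by rw [hσ, subarc_one, hqB]
  have hc : IsClosedChain ![1, 1] ![σ, κ] := by
    intro φ
    simp [Fin.sum_univ_two, hσ0, hσ1, hκ, circleArc_zero, circleArc_one]
  have hc' : IsClosedChain ![1, -1] ![σ, κ'] := by
    intro φ
    simp [Fin.sum_univ_two, hσ0, hσ1, hκ', circleArc_zero, circleArc_one, add_mul, Complex.exp_add]
  have hκr : range κ ⊆ Metric.sphere x r := range_circleArc_subset x hr _ _
  have hκ'r : range κ' ⊆ Metric.sphere x r := range_circleArc_subset x hr _ _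
  have hκκ' : range κ ∩ range κ' ⊆ range σ := by
    rintro _ ⟨⟨s, rfl⟩, ⟨t, ht⟩⟩
    rcases circleArc_eq_circleArc hr hBA hAB ht.symm with rfl | rfl
    · exact ⟨1, by rw [hσ1, hκ, circleArc_zero]⟩
    · exact ⟨0, by rw [hσ0, hκ, circleArc_one]⟩
  have hκi : Function.Injective κ := circleArc_injective x hr hBA hAB
  have hκ'i : Function.Injective κ' := circleArc_injective x hr hAB (by linarith)
  obtain ⟨τ, hτ⟩ : t₀ ∈ range (unitInterval.segmentMap a b) := by
    rw [unitInterval.range_segmentMap hab.le]; exact ⟨hat.le, htb.le⟩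
  have hστ : σ τ = x := by rw [hσ, subarc, ContinuousMap.comp_apply, hτ]
  have hτ0 : 0 < τ := unitInterval.pos_iff_ne_zero.2 fun h => by
    rw [h, unitInterval.segmentMap_zero] at hτ; exact hat.ne hτ
  have hτ1 : τ < 1 := unitInterval.lt_one_iff_ne_one.2 fun h => by
    rw [h, unitInterval.segmentMap_one] at hτ; exact htb.ne' hτ
  have hxa : x ∉ range (subarc γ 0 a) := by
    rw [range_subarc _ ha0.le]
    rintro ⟨t, ht, htx⟩
    rw [hinj t htx] at ht
    exact absurd ht.2 hat.not_ge
  have hxb : x ∉ range (subarc γ b 1) := by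
    rw [range_subarc _ hb1.le]
    rintro ⟨t, ht, htx⟩
    rw [hinj t htx] at ht
    exact absurd ht.1 htb.not_ge
  have hxκ : ∀ a b, x ∉ range (circleArc x r a b) := fun a b hm => by
    have := range_circleArc_subset x hr a b hm
    rw [mem_sphere_iff_norm, sub_self, norm_zero] at this
    exact hr.ne this
  have hN : ∀ᶠ z in 𝓝 x, z ∈ Metric.ball x r ∧ z ∉ range (subarc γ 0 a) ∧
      z ∉ range (subarc γ b 1) := by
    have ho : ∀ γ : C(unitInterval, ℂ), x ∉ range γ → ∀ᶠ z in 𝓝 x, z ∉ range γ := fun γ h =>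
      (isCompact_range γ.continuous).isClosed.isOpen_compl.mem_nhds h
    have hb : ∀ᶠ z in 𝓝 x, z ∈ Metric.ball x r := Metric.ball_mem_nhds x hr
    exact hb.and ((ho _ hxa).and (ho _ hxb))
  have hcover : ∀ z, z ∉ range (subarc γ 0 a) → z ∉ range (subarc γ b 1) → z ∉ range σ →
      z ∉ range γ := by
    rintro z hz1 hz2 hz3 ⟨t, rfl⟩
    rw [range_subarc _ ha0.le] at hz1
    rw [range_subarc _ hb1.le] at hz2
    rw [hσ, range_subarc _ hab.le] at hz3
    rcases le_total t a with h | h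
    · exact hz1 ⟨t, ⟨t.2.1, h⟩, rfl⟩
    · rcases le_total t b with h' | h'
      · exact hz3 ⟨t, ⟨h, h'⟩, rfl⟩
      · exact hz2 ⟨t, ⟨h', t.2.2⟩, rfl⟩
  have hW : ∀ z, chainSweep ![1, 1] ![σ, κ] z = sweep σ z + sweep κ z := fun z => by
    simp [chainSweep, Fin.sum_univ_two]
  have hW' : ∀ z, chainSweep ![1, -1] ![σ, κ'] z = sweep σ z - sweep κ' z := fun z => by
    simp [chainSweep, Fin.sum_univ_two, sub_eq_add_neg]
  have hfreq : ∀ {p : ℂ → Prop}, (∀ ε > 0, ∃ z ∈ Metric.ball x ε, p z) → ∃ᶠ z in 𝓝 x, p z := by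
    intro p hp
    rw [Metric.nhds_basis_ball.frequently_iff]
    exact fun ε hε => hp ε hε
  refine ⟨fun z => sweep (subarc γ 0 a) z + sweep (subarc γ b 1) z - sweep κ z,
    ((continuousAt_sweep hxa).add (continuousAt_sweep hxb)).sub (continuousAt_sweep (hxκ _ _)),
    ?_, ?_, ?_⟩
  · filter_upwards [hN] with z ⟨hzr, hza, hzb⟩ hz
    rw [sweep_eq_add_subarc hz a b, ← hσ]
    have hsum := sweep_circleArc_add hr A B hzr
    rw [← hκ, ← hκ'] at hsum
    rcases crosscut_chainSweep_eq_zero_or hc hc' hσi hr hσr hκr hκ'r hκκ' hzr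
      (fun h => hz (range_subarc_subset _ _ _ h)) with h | h
    · rw [hW] at h; left; linarith
    · rw [hW'] at h; right; linarith
  · have hf : ∃ᶠ z in 𝓝 x, z ∉ range σ ∧ z ∉ range κ ∧ chainSweep ![1, 1] ![σ, κ] z = 0 :=
      hfreq fun ε hε => by
        rw [← hστ]
        exact exists_chainSweep_eq_zero_near hc hσi hκi
          (fun t ht => hsph t (hκr ht)) hτ0 hτ1 hε
    refine (hf.and_eventually hN).mono ?_
    rintro z ⟨⟨h1, -, h2⟩, -, h3, h4⟩
    have hz := hcover z h3 h4 h1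
    refine ⟨hz, ?_⟩
    rw [sweep_eq_add_subarc hz a b, ← hσ]
    rw [hW] at h2
    linarith
  · have hf : ∃ᶠ z in 𝓝 x, z ∉ range σ ∧ z ∉ range κ' ∧ chainSweep ![1, -1] ![σ, κ'] z = 0 :=
      hfreq fun ε hε => by
        rw [← hστ]
        exact exists_chainSweep_eq_zero_near hc' hσi hκ'i
          (fun t ht => hsph t (hκ'r ht)) hτ0 hτ1 hε
    refine (hf.and_eventually hN).mono ?_
    rintro z ⟨⟨h1, -, h2⟩, h5, h3, h4⟩
    have hz := hcover z h3 h4 h1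
    refine ⟨hz, ?_⟩
    have hsum := sweep_circleArc_add hr A B h5
    rw [← hκ, ← hκ'] at hsum
    rw [sweep_eq_add_subarc hz a b, ← hσ]
    rw [hW'] at h2
    linarith

theorem IsPreconnected.constant_of_eventually {X Y : Type*} [TopologicalSpace X] {S : Set X}
    (hS : IsPreconnected S) {f : X → Y} (hf : ∀ x ∈ S, ∀ᶠ y in 𝓝[S] x, f y = f x) {x y : X}
    (hx : x ∈ S) (hy : y ∈ S) : f x = f y := by
  let : TopologicalSpace Y := ⊥
  have : DiscreteTopology Y := ⟨rfl⟩
  refine hS.constant (f := f) (fun x hx => ?_) hx hy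
  exact Tendsto.congr' ((hf x hx).mono fun y h => h.symm) tendsto_const_nhds

theorem exists_unitInterval_mem_Ioo : ∃ t : unitInterval, 0 < t ∧ t < 1 := exists_between zero_lt_one

namespace PlaneGraph

variable {V E : Type*} (G : PlaneGraph V E)

theorem arc_mem_range_pos {e : E} {t : unitInterval} (h : G.arc e t ∈ range G.pos) :
    t = 0 ∨ t = 1 := by
  by_contra! hcon
  obtain ⟨v, hv⟩ := h
  exact G.arc_ne_pos e t (unitInterval.pos_iff_ne_zero.2 hcon.1)
    (unitInterval.lt_one_iff_ne_one.2 hcon.2) v hv.symm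

theorem arc_mem_range_pos' {e : E} {t : unitInterval} (h : t = 0 ∨ t = 1) :
    G.arc e t ∈ range G.pos := by
  rcases h with rfl | rfl
  exacts [⟨_, (G.arc_zero e).symm⟩, ⟨_, (G.arc_one e).symm⟩]

theorem arc_eq_arc {e e' : E} {t t' : unitInterval} (h0 : 0 < t) (h1 : t < 1)
    (h : G.arc e t = G.arc e' t') : e = e' ∧ t = t' := by
  by_cases ht' : t' = 0 ∨ t' = 1
  · rcases G.arc_mem_range_pos (h ▸ G.arc_mem_range_pos' ht') with rfl | rfl
    exacts [absurd h0 (lt_irrefl _), absurd h1 (lt_irrefl _)]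
  · rw [not_or] at ht'
    exact G.arc_injective e e' t t' h0 h1 (unitInterval.pos_iff_ne_zero.2 ht'.1)
      (unitInterval.lt_one_iff_ne_one.2 ht'.2) h

theorem isSimpleArc (e : E) : IsSimpleArc (G.arc e) := by
  intro t t' h
  by_cases ht : t = 0 ∨ t = 1
  · have ht' := G.arc_mem_range_pos (h ▸ G.arc_mem_range_pos' ht)
    rcases ht with rfl | rfl <;> rcases ht' with rfl | rfl <;> simp
  · rw [not_or] at ht
    exact Or.inl (G.arc_eq_arc (unitInterval.pos_iff_ne_zero.2 ht.1)
      (unitInterval.lt_one_iff_ne_one.2 ht.2) h).2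

/-- The graph without the interior of the edge `e`. -/
def rest (e : E) : Set ℂ := range G.pos ∪ ⋃ e' ∈ {e' | e' ≠ e}, range (G.arc e')

theorem support_eq_rest_union (e : E) : G.support = G.rest e ∪ range (G.arc e) := by
  ext z
  simp only [support, rest, mem_union, mem_iUnion, mem_ofPred_eq]
  constructor
  · rintro (h | ⟨e', h⟩)
    · exact Or.inl (Or.inl h)
    · by_cases he : e' = e
      · exact Or.inr (he ▸ h)
      · exact Or.inl (Or.inr ⟨e', he, h⟩)
  · rintro ((h | ⟨e', -, h⟩) | h)
    exacts [Or.inl h, Or.inr ⟨e', h⟩, Or.inr ⟨e, h⟩]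

theorem isCompact_rest (e : E) : IsCompact (G.rest e) := by
  have := G.finite_vertices
  have := G.finite_edges
  exact (finite_range _).isCompact.union
    ((toFinite _).isCompact_biUnion fun e' _ => isCompact_range (G.arc e').continuous)

theorem isCompact_support : IsCompact G.support := by
  have := G.finite_vertices
  have := G.finite_edges
  exact (finite_range _).isCompact.union
    (isCompact_iUnion fun e => isCompact_range (G.arc e).continuous)

theorem arc_mem_rest {e : E} {t : unitInterval} (h : G.arc e t ∈ G.rest e) : t = 0 ∨ t = 1 := by
  rcases h with h | h
  · exact G.arc_mem_range_pos h
  · simp only [mem_iUnion, mem_ofPred_eq] at h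
    obtain ⟨e', he', t', ht'⟩ := h
    by_contra! hcon
    exact he' (G.arc_eq_arc (unitInterval.pos_iff_ne_zero.2 hcon.1)
      (unitInterval.lt_one_iff_ne_one.2 hcon.2) ht'.symm).1.symm

theorem arc_notMem_rest {e : E} {t : unitInterval} (h0 : 0 < t) (h1 : t < 1) :
    G.arc e t ∉ G.rest e := fun h => by
  rcases G.arc_mem_rest h with rfl | rfl
  exacts [lt_irrefl _ h0, lt_irrefl _ h1]

theorem range_arc_subset (e : E) : range (G.arc e) ⊆ G.support := fun _ h =>
  Or.inr (mem_iUnion.2 ⟨e, h⟩)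

theorem notMem_range_arc {z : ℂ} (hz : z ∉ G.support) (e : E) : z ∉ range (G.arc e) := fun h =>
  hz (G.range_arc_subset e h)

theorem eventually_notMem_support {e : E} {t : unitInterval} (h0 : 0 < t) (h1 : t < 1) :
    ∀ᶠ z in 𝓝 (G.arc e t), z ∉ G.rest e :=
  (G.isCompact_rest e).isClosed.isOpen_compl.mem_nhds (G.arc_notMem_rest h0 h1)

/-- The interior face containing a point off the graph, or `none` in the exterior. -/
noncomputable def faceOf (z : ℂ) : Option G.InteriorFace :=
  open Classical in
  if h : z ∈ G.supportᶜ ∧ Bornology.IsBounded (connectedComponentIn G.supportᶜ z) then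
    some ⟨_, h.2, z, h.1, rfl⟩ else none

variable {G}

theorem faceOf_eq_none_iff {z : ℂ} (hz : z ∉ G.support) : G.faceOf z = none ↔
    ¬ Bornology.IsBounded (connectedComponentIn G.supportᶜ z) := by
  simp only [faceOf, mem_compl_iff]
  split_ifs with h
  · simp [h.2]
  · simp only [true_iff]; tauto

theorem faceOf_eq_some_iff {z : ℂ} (hz : z ∉ G.support) {F : G.InteriorFace} :
    G.faceOf z = some F ↔ z ∈ F.1 := by
  obtain ⟨F, hb, y, hy, rfl⟩ := F
  simp only [faceOf]
  constructor
  · split_ifs with h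
    · intro he
      have he' := congr_arg Subtype.val (Option.some.inj he)
      exact (Set.ext_iff.1 he' z).1 (mem_connectedComponentIn hz)
    · intro he; cases he
  · intro hm
    have he := connectedComponentIn_eq hm
    rw [dif_pos ⟨hz, he ▸ hb⟩]
    simp only [he]

theorem InteriorFace.subset (F : G.InteriorFace) : F.1 ⊆ G.supportᶜ := by
  obtain ⟨F, hb, y, hy, rfl⟩ := F
  exact connectedComponentIn_subset _ _

theorem mem_interiorFace_iff {F : G.InteriorFace} {z : ℂ} :
    z ∈ F.1 ↔ z ∉ G.support ∧ G.faceOf z = some F :=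
  ⟨fun h => ⟨F.subset h, (faceOf_eq_some_iff (F.subset h)).2 h⟩,
    fun h => (faceOf_eq_some_iff h.1).1 h.2⟩

theorem mem_exteriorFace_iff {z : ℂ} :
    z ∈ G.exteriorFace ↔ z ∉ G.support ∧ G.faceOf z = none :=
  and_congr_right fun h => (faceOf_eq_none_iff h).symm

theorem faceOf_congr {z z' : ℂ} (hz : z ∉ G.support) (hz' : z' ∉ G.support)
    (h : connectedComponentIn G.supportᶜ z = connectedComponentIn G.supportᶜ z' ∨
      ¬ Bornology.IsBounded (connectedComponentIn G.supportᶜ z) ∧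
      ¬ Bornology.IsBounded (connectedComponentIn G.supportᶜ z')) : G.faceOf z = G.faceOf z' := by
  rcases h with h | ⟨h, h'⟩
  · by_cases hb : Bornology.IsBounded (connectedComponentIn G.supportᶜ z)
    · rw [faceOf, faceOf, dif_pos ⟨hz, hb⟩, dif_pos ⟨hz', h ▸ hb⟩]
      simp only [h]
    · rw [(faceOf_eq_none_iff hz).2 hb, (faceOf_eq_none_iff hz').2 (h ▸ hb)]
  · rw [(faceOf_eq_none_iff hz).2 h, (faceOf_eq_none_iff hz').2 h']

theorem exists_faceOf_eq (F : Option G.InteriorFace) : ∃ z, z ∉ G.support ∧ G.faceOf z = F := by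
  rcases F with _ | F
  · obtain ⟨R, hR⟩ := G.isCompact_support.isBounded.exists_norm_le
    have hR' : 0 < |R| + 1 := by positivity
    have hS : ((fun s : ℝ => (s : ℂ)) '' Ici (|R| + 1)) ⊆ G.supportᶜ := by
      rintro _ ⟨s, hs, rfl⟩ hm
      have := hR _ hm
      rw [Complex.norm_real, Real.norm_eq_abs] at this
      linarith [le_abs_self s, le_abs_self R, mem_Ici.1 hs]
    have hm : ((|R| + 1 : ℝ) : ℂ) ∈ (fun s : ℝ => (s : ℂ)) '' Ici (|R| + 1) :=
      ⟨_, mem_Ici.2 le_rfl, rfl⟩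
    refine ⟨_, hS hm, (faceOf_eq_none_iff (hS hm)).2 fun hb => ?_⟩
    have hb' := hb.subset ((isPreconnected_Ici.image _
      Complex.continuous_ofReal.continuousOn).subset_connectedComponentIn hm hS)
    obtain ⟨M, hM⟩ := hb'.exists_norm_le
    have h2 := hM _ ⟨max (|R| + 1) (M + 1), mem_Ici.2 (le_max_left _ _), rfl⟩
    rw [Complex.norm_real, Real.norm_eq_abs] at h2
    linarith [le_abs_self (max (|R| + 1) (M + 1)), le_max_right (|R| + 1) (M + 1)]
  · obtain ⟨F, hb, y, hy, rfl⟩ := F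
    exact ⟨y, hy, (faceOf_eq_some_iff hy).2 (mem_connectedComponentIn hy)⟩

theorem eventually_faceOf_eq {z : ℂ} (hz : z ∉ G.support) :
    ∀ᶠ w in 𝓝 z, w ∉ G.support ∧ G.faceOf w = G.faceOf z := by
  have ho := G.isCompact_support.isClosed.isOpen_compl
  filter_upwards [(ho.connectedComponentIn (x := z)).mem_nhds (mem_connectedComponentIn hz)]
    with w hw
  have hw' := connectedComponentIn_subset _ _ hw
  exact ⟨hw', faceOf_congr hw' hz (Or.inl (connectedComponentIn_eq hw).symm)⟩

theorem exists_ball_faceOf_eq {e : E} {t : unitInterval} (h0 : 0 < t) (h1 : t < 1) :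
    ∃ U ∈ 𝓝 (G.arc e t), ∀ z ∈ U, ∀ z' ∈ U, z ∉ G.support → z' ∉ G.support →
      |sweep (G.arc e) z - sweep (G.arc e) z'| < Real.pi → G.faceOf z = G.faceOf z' := by
  obtain ⟨d, hd, hsub⟩ := Metric.eventually_nhds_iff_ball.1 (G.eventually_notMem_support h0 h1)
  refine ⟨_, Metric.ball_mem_nhds _ (by positivity : 0 < d / 4), fun z hz z' hz' hzs hzs' hs => ?_⟩
  refine faceOf_congr hzs hzs' ?_
  rw [G.support_eq_rest_union e] at hzs hzs' ⊢
  simp only [mem_union, not_or] at hzs hzs'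
  rw [Metric.mem_ball] at hz hz'
  refine connectedComponentIn_compl_union_range (G.isCompact_rest e) (G.isSimpleArc e)
    (Or.inl (G.arc_mem_range_pos' (Or.inl rfl))) (Or.inl (G.arc_mem_range_pos' (Or.inr rfl)))
    (fun t ht => G.arc_mem_rest ht) hzs.2 hzs'.2 (fun ζ hζ => ?_) hzs.1 hs
  have h2 : d ≤ dist ζ (G.arc e t) := by
    by_contra! hlt
    exact hsub ζ hlt hζ
  rw [← dist_eq_norm, ← dist_eq_norm]
  have h3 := dist_triangle_right z z' (G.arc e t)
  have h4 := dist_triangle ζ z' (G.arc e t)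
  linarith

/-- The local description of the two sides of the edge `e` at time `t`. -/
structure IsSides (e : E) (t : unitInterval) (L R : Option G.InteriorFace) (β : ℂ → ℝ) : Prop where
  continuousAt : ContinuousAt β (G.arc e t)
  eventually : ∀ᶠ z in 𝓝 (G.arc e t), z ∉ G.support →
    sweep (G.arc e) z = β z ∧ G.faceOf z = R ∨
      sweep (G.arc e) z = β z + 2 * Real.pi ∧ G.faceOf z = L
  right : ∃ᶠ z in 𝓝 (G.arc e t), z ∉ G.support ∧ sweep (G.arc e) z = β z ∧ G.faceOf z = R
  left : ∃ᶠ z in 𝓝 (G.arc e t), z ∉ G.support ∧ sweep (G.arc e) z = β z + 2 * Real.pi ∧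
    G.faceOf z = L

theorem eventually_abs_sub_lt {β : ℂ → ℝ} {x : ℂ} (h : ContinuousAt β x) {ε : ℝ} (hε : 0 < ε) :
    ∀ᶠ z in 𝓝 x, |β z - β x| < ε := Metric.tendsto_nhds.1 h ε hε

theorem exists_isSides_at (e : E) {t : unitInterval} (h0 : 0 < t) (h1 : t < 1) :
    ∃ L R β, G.IsSides e t L R β := by
  obtain ⟨β, hβ, hev, hlo, hhi⟩ := (G.isSimpleArc e).exists_local_sweep h0 h1
  obtain ⟨U, hU, hUf⟩ := exists_ball_faceOf_eq (G := G) (e := e) h0 h1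
  have hUe : ∀ᶠ z in 𝓝 (G.arc e t), z ∈ U := hU
  have hoff := G.eventually_notMem_support (e := e) h0 h1
  have hnot : ∀ {z}, z ∉ G.rest e → z ∉ range (G.arc e) → z ∉ G.support := fun h h' => by
    rw [G.support_eq_rest_union e]
    exact fun hm => hm.elim h h'
  have hB := eventually_abs_sub_lt hβ one_half_pos
  have hgood := (hUe.and hoff).and hB
  obtain ⟨z₀, ⟨hz₀, hz₀'⟩, ⟨hz₀U, hz₀r⟩, hz₀B⟩ := (hlo.and_eventually hgood).exists
  obtain ⟨w₀, ⟨hw₀, hw₀'⟩, ⟨hw₀U, hw₀r⟩, hw₀B⟩ := (hhi.and_eventually hgood).exists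
  have hpi := Real.pi_gt_three
  have hR : ∀ z, z ∈ U → |β z - β (G.arc e t)| < 1 / 2 → z ∉ G.support →
      sweep (G.arc e) z = β z → G.faceOf z = G.faceOf z₀ := fun z hz hzB hzs hzw => by
    refine hUf z hz z₀ hz₀U hzs (hnot hz₀r hz₀) ?_
    rw [hzw, hz₀', abs_lt]
    rw [abs_lt] at hzB hz₀B
    constructor <;> linarith
  have hL : ∀ z, z ∈ U → |β z - β (G.arc e t)| < 1 / 2 → z ∉ G.support →
      sweep (G.arc e) z = β z + 2 * Real.pi → G.faceOf z = G.faceOf w₀ := fun z hz hzB hzs hzw => by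
    refine hUf z hz w₀ hw₀U hzs (hnot hw₀r hw₀) ?_
    rw [hzw, hw₀', abs_lt]
    rw [abs_lt] at hzB hw₀B
    constructor <;> linarith
  refine ⟨G.faceOf w₀, G.faceOf z₀, β, hβ, ?_, ?_, ?_⟩
  · filter_upwards [hev, hgood] with z hz hzg hzs
    exact (hz (G.notMem_range_arc hzs e)).imp (fun h => ⟨h, hR z hzg.1.1 hzg.2 hzs h⟩)
      fun h => ⟨h, hL z hzg.1.1 hzg.2 hzs h⟩
  · refine (hlo.and_eventually hgood).mono fun z hz => ?_
    have hzs := hnot hz.2.1.2 hz.1.1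
    exact ⟨hzs, hz.1.2, hR z hz.2.1.1 hz.2.2 hzs hz.1.2⟩
  · refine (hhi.and_eventually hgood).mono fun z hz => ?_
    have hzs := hnot hz.2.1.2 hz.1.1
    exact ⟨hzs, hz.1.2, hL z hz.2.1.1 hz.2.2 hzs hz.1.2⟩

theorem IsSides.eventually_eq {e : E} {t : unitInterval} {L R : Option G.InteriorFace} {β : ℂ → ℝ}
    (h : G.IsSides e t L R β) : ∀ᶠ s in 𝓝 t, ∀ L' R' β', G.IsSides e s L' R' β' →
      L' = L ∧ R' = R := by
  have hgood := (h.eventually.and (eventually_abs_sub_lt h.continuousAt one_half_pos)).eventually_nhds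
  filter_upwards [(G.arc e).continuous.continuousAt.eventually hgood] with s hs L' R' β' h'
  have hpi := Real.pi_gt_three
  have hB := eventually_abs_sub_lt h'.continuousAt one_half_pos
  obtain ⟨z, ⟨hz, hzβ, hzR⟩, hzB, hzev, hzB'⟩ := (h'.right.and_eventually (hB.and hs)).exists
  obtain ⟨w, ⟨hw, hwβ, hwL⟩, hwB, hwev, hwB'⟩ := (h'.left.and_eventually (hB.and hs)).exists
  rw [abs_lt] at hzB hzB' hwB hwB'
  rcases hzev hz with ⟨hz1, hz2⟩ | ⟨hz1, hz2⟩ <;> rcases hwev hw with ⟨hw1, hw2⟩ | ⟨hw1, hw2⟩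
  · linarith
  · exact ⟨hwL.symm.trans hw2, hzR.symm.trans hz2⟩
  · linarith
  · linarith

theorem exists_sides (e : E) : ∃ L R : Option G.InteriorFace, ∀ t : unitInterval, 0 < t → t < 1 →
    ∃ β, G.IsSides e t L R β := by
  choose! L R β h using fun (t : unitInterval) (ht : 0 < t ∧ t < 1) =>
    exists_isSides_at (G := G) e ht.1 ht.2
  obtain ⟨t₀, ht₀⟩ := exists_unitInterval_mem_Ioo
  refine ⟨L t₀, R t₀, fun t h0 h1 => ⟨β t, ?_⟩⟩
  have := isPreconnected_Ioo.constant_of_eventually (f := fun t => (L t, R t))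
    (S := Ioo (0 : unitInterval) 1) (fun t ht => by
      filter_upwards [(h t ht).eventually_eq.filter_mono nhdsWithin_le_nhds, self_mem_nhdsWithin]
        with s hs hs'
      exact Prod.ext_iff.2 (hs _ _ _ (h s hs'))) (show t ∈ Ioo 0 1 from ⟨h0, h1⟩) ht₀
  rw [Prod.mk.injEq] at this
  rw [← this.1, ← this.2]
  exact h t ⟨h0, h1⟩

/-- The face on the left of an edge. -/
noncomputable def leftFace (e : E) : Option G.InteriorFace := (exists_sides (G := G) e).choose

/-- The face on the right of an edge. -/
noncomputable def rightFace (e : E) : Option G.InteriorFace :=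
  (exists_sides (G := G) e).choose_spec.choose

theorem exists_isSides (e : E) {t : unitInterval} (h0 : 0 < t) (h1 : t < 1) :
    ∃ β, G.IsSides e t (G.leftFace e) (G.rightFace e) β :=
  (exists_sides (G := G) e).choose_spec.choose_spec t h0 h1

theorem onLeft_iff {S : Set ℂ} {F : Option G.InteriorFace}
    (hS : ∀ z, z ∈ S ↔ z ∉ G.support ∧ G.faceOf z = F) {e : E} :
    G.OnLeft S e ↔ G.leftFace e = F := by
  have hpi := Real.pi_gt_three
  constructor
  · rintro ⟨t, h0, h1, h⟩
    obtain ⟨β, hβ⟩ := exists_isSides (G := G) e h0 h1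
    obtain ⟨ε, hε, hball⟩ := Metric.eventually_nhds_iff_ball.1
      (hβ.eventually.and (eventually_abs_sub_lt hβ.continuousAt one_half_pos))
    obtain ⟨z, hz, w, hw, hzε, hwε, a, b, ha, hb, hab⟩ := h ε hε
    obtain ⟨hzs, hzF⟩ := (hS z).1 hz
    rw [ha.eq_sweep (G.notMem_range_arc hzs e), hb.eq_sweep (G.notMem_range_arc hw e)] at hab
    obtain ⟨hz1, hz2⟩ := hball z hzε
    obtain ⟨hw1, hw2⟩ := hball w hwε
    rw [abs_lt] at hz2 hw2
    rcases hz1 hzs with ⟨hz3, hz4⟩ | ⟨hz3, hz4⟩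
    · rcases hw1 hw with ⟨hw3, hw4⟩ | ⟨hw3, hw4⟩ <;> linarith
    · rw [← hz4, hzF]
  · intro hF
    obtain ⟨t, h0, h1⟩ := exists_unitInterval_mem_Ioo
    obtain ⟨β, hβ⟩ := exists_isSides (G := G) e h0 h1
    refine ⟨t, h0, h1, fun ε hε => ?_⟩
    have hb : ∀ᶠ z in 𝓝 (G.arc e t), dist z (G.arc e t) < ε := Metric.ball_mem_nhds _ hε
    have hev := hb.and (eventually_abs_sub_lt hβ.continuousAt one_half_pos)
    obtain ⟨z, ⟨hz1, hz2, hz3⟩, hz4, hz5⟩ := (hβ.left.and_eventually hev).exists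
    obtain ⟨w, ⟨hw1, hw2, hw3⟩, hw4, hw5⟩ := (hβ.right.and_eventually hev).exists
    refine ⟨z, (hS z).2 ⟨hz1, hz3.trans hF⟩, w, hw1, hz4, hw4, _, _,
      sweepsAngle_sweep (G.notMem_range_arc hz1 e), sweepsAngle_sweep (G.notMem_range_arc hw1 e), ?_⟩
    rw [abs_lt] at hz5 hw5
    linarith

theorem onRight_iff {S : Set ℂ} {F : Option G.InteriorFace}
    (hS : ∀ z, z ∈ S ↔ z ∉ G.support ∧ G.faceOf z = F) {e : E} :
    G.OnRight S e ↔ G.rightFace e = F := by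
  have hpi := Real.pi_gt_three
  constructor
  · rintro ⟨t, h0, h1, h⟩
    obtain ⟨β, hβ⟩ := exists_isSides (G := G) e h0 h1
    obtain ⟨ε, hε, hball⟩ := Metric.eventually_nhds_iff_ball.1
      (hβ.eventually.and (eventually_abs_sub_lt hβ.continuousAt one_half_pos))
    obtain ⟨z, hz, w, hw, hzε, hwε, a, b, ha, hb, hab⟩ := h ε hε
    obtain ⟨hzs, hzF⟩ := (hS z).1 hz
    rw [ha.eq_sweep (G.notMem_range_arc hzs e), hb.eq_sweep (G.notMem_range_arc hw e)] at hab
    obtain ⟨hz1, hz2⟩ := hball z hzε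
    obtain ⟨hw1, hw2⟩ := hball w hwε
    rw [abs_lt] at hz2 hw2
    rcases hz1 hzs with ⟨hz3, hz4⟩ | ⟨hz3, hz4⟩
    · rw [← hz4, hzF]
    · rcases hw1 hw with ⟨hw3, hw4⟩ | ⟨hw3, hw4⟩ <;> linarith
  · intro hF
    obtain ⟨t, h0, h1⟩ := exists_unitInterval_mem_Ioo
    obtain ⟨β, hβ⟩ := exists_isSides (G := G) e h0 h1
    refine ⟨t, h0, h1, fun ε hε => ?_⟩
    have hb : ∀ᶠ z in 𝓝 (G.arc e t), dist z (G.arc e t) < ε := Metric.ball_mem_nhds _ hε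
    have hev := hb.and (eventually_abs_sub_lt hβ.continuousAt one_half_pos)
    obtain ⟨z, ⟨hz1, hz2, hz3⟩, hz4, hz5⟩ := (hβ.right.and_eventually hev).exists
    obtain ⟨w, ⟨hw1, hw2, hw3⟩, hw4, hw5⟩ := (hβ.left.and_eventually hev).exists
    refine ⟨z, (hS z).2 ⟨hz1, hz3.trans hF⟩, w, hw1, hz4, hw4, _, _,
      sweepsAngle_sweep (G.notMem_range_arc hz1 e), sweepsAngle_sweep (G.notMem_range_arc hw1 e), ?_⟩
    rw [abs_lt] at hz5 hw5
    linarith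

/-- A function of the faces which takes the same value on the two sides of every edge is
constant. -/
theorem eq_of_leftFace_eq_rightFace {Y : Type*} {g : Option G.InteriorFace → Y}
    (hg : ∀ e, g (G.leftFace e) = g (G.rightFace e)) (F F' : Option G.InteriorFace) :
    g F = g F' := by
  classical
  have := G.finite_vertices
  let H : ℂ → Y := fun z =>
    if h : ∃ e t, 0 < t ∧ t < 1 ∧ G.arc e t = z then g (G.leftFace h.choose) else g (G.faceOf z)
  have hHarc : ∀ e t, 0 < t → t < 1 → H (G.arc e t) = g (G.leftFace e) := by
    intro e t h0 h1
    have h : ∃ e' t', 0 < t' ∧ t' < 1 ∧ G.arc e' t' = G.arc e t := ⟨e, t, h0, h1, rfl⟩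
    simp only [H, dif_pos h]
    obtain ⟨t', -, -, ht'⟩ := h.choose_spec
    rw [← (G.arc_eq_arc h0 h1 ht'.symm).1]
  have hHoff : ∀ z, z ∉ G.support → H z = g (G.faceOf z) := by
    intro z hz
    simp only [H]
    rw [dif_neg]
    rintro ⟨e, t, -, -, rfl⟩
    exact hz (G.range_arc_subset e (mem_range_self t))
  have hloc : ∀ z ∈ (range G.pos)ᶜ, ∀ᶠ w in 𝓝[(range G.pos)ᶜ] z, H w = H z := by
    intro z hz
    by_cases hzs : z ∈ G.support
    · rcases hzs with hzs | hzs
      · exact absurd hzs hz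
      obtain ⟨e, t, rfl⟩ := mem_iUnion.1 hzs
      have h0 : 0 < t := unitInterval.pos_iff_ne_zero.2 fun h =>
        hz (G.arc_mem_range_pos' (Or.inl h))
      have h1 : t < 1 := unitInterval.lt_one_iff_ne_one.2 fun h =>
        hz (G.arc_mem_range_pos' (Or.inr h))
      obtain ⟨β, hβ⟩ := exists_isSides (G := G) e h0 h1
      refine Filter.Eventually.filter_mono nhdsWithin_le_nhds ?_
      filter_upwards [hβ.eventually, G.eventually_notMem_support h0 h1] with w hw hwr
      rw [hHarc e t h0 h1]
      by_cases hws : w ∈ G.support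
      · rw [G.support_eq_rest_union e] at hws
        obtain ⟨s, rfl⟩ := hws.resolve_left hwr
        refine hHarc e s ?_ ?_
        · exact unitInterval.pos_iff_ne_zero.2 fun h =>
            hwr (Or.inl (G.arc_mem_range_pos' (Or.inl h)))
        · exact unitInterval.lt_one_iff_ne_one.2 fun h =>
            hwr (Or.inl (G.arc_mem_range_pos' (Or.inr h)))
      · rw [hHoff w hws]
        rcases hw hws with ⟨-, h⟩ | ⟨-, h⟩
        · rw [h, hg]
        · rw [h]
    · refine Filter.Eventually.filter_mono nhdsWithin_le_nhds ?_
      filter_upwards [eventually_faceOf_eq hzs] with w hw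
      rw [hHoff z hzs, hHoff w hw.1, hw.2]
  have hconn : IsPreconnected (range G.pos)ᶜ :=
    ((finite_range G.pos).countable.isConnected_compl_of_one_lt_rank
      (by simp)).isPreconnected
  obtain ⟨z, hz, rfl⟩ := exists_faceOf_eq F
  obtain ⟨z', hz', rfl⟩ := exists_faceOf_eq F'
  rw [← hHoff z hz, ← hHoff z' hz']
  exact hconn.constant_of_eventually hloc (fun h => hz (Or.inl h)) fun h => hz' (Or.inl h)

/-- The winding numbers of an integral circulation around the faces and around the vertices off
its support. -/
theorem exists_winding [Fintype E] (f : E → ℤ)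
    (hf : ∀ φ : V → ℝ, ∑ e, (f e : ℝ) * (φ (G.tgt e) - φ (G.src e)) = 0) :
    ∃ (w : Option G.InteriorFace → ℤ) (u : V → ℤ), w none = 0 ∧
      (∀ e, w (G.leftFace e) - w (G.rightFace e) = f e) ∧
      ∀ v, (∀ e, G.src e = v ∨ G.tgt e = v → f e = 0) →
        ∀ e, G.src e = v ∨ G.tgt e = v → w (G.leftFace e) = u v := by
  classical
  have hcl : IsClosedChain f G.arc := fun φ => by
    simp only [G.arc_zero, G.arc_one]
    exact hf (φ ∘ G.pos)
  have hpi := Real.pi_gt_three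
  set W := chainSweep f G.arc with hW
  let n : ℂ → ℤ := fun z => round (W z / (2 * Real.pi))
  have hn : ∀ z, (∀ e, f e ≠ 0 → z ∉ range (G.arc e)) → W z = 2 * Real.pi * n z := by
    intro z hz
    obtain ⟨k, hk⟩ := hcl.chainSweep_int hz
    simp only [n]
    rw [← hW] at hk
    rw [hk, mul_div_cancel_left₀ _ (by positivity), round_intCast]
  let w : Option G.InteriorFace → ℤ := fun F => F.elim 0 fun F => n F.2.2.choose
  have hw : ∀ z, z ∉ G.support → W z = 2 * Real.pi * w (G.faceOf z) := by
    intro z hz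
    have hd : ∀ y ∈ connectedComponentIn G.supportᶜ z, ∀ e, f e ≠ 0 → y ∉ range (G.arc e) :=
      fun y hy e _ => G.notMem_range_arc (connectedComponentIn_subset _ _ hy) e
    rcases hF : G.faceOf z with _ | F
    · simp only [w, Option.elim_none, Int.cast_zero, mul_zero]
      exact hcl.chainSweep_eq_zero isPreconnected_connectedComponentIn hd
        ((faceOf_eq_none_iff hz).1 hF) (mem_connectedComponentIn hz)
    · simp only [w, Option.elim_some]
      have hs := F.2.2.choose_spec
      rw [← hn _ fun e _ => G.notMem_range_arc hs.1 e]
      have hzF := (faceOf_eq_some_iff hz).1 hF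
      rw [hs.2] at hzF
      refine hcl.chainSweep_eq isPreconnected_connectedComponentIn hd (mem_connectedComponentIn hz) ?_
      rw [← connectedComponentIn_eq hzF]
      exact mem_connectedComponentIn hs.1
  have heq : ∀ k m : ℤ, |2 * Real.pi * k - 2 * Real.pi * m| < 2 * Real.pi → k = m := by
    intro k m h
    have := eq_of_abs_sub_lt_of_int_multiples ⟨k, rfl⟩ ⟨m, rfl⟩ h
    exact_mod_cast mul_left_cancel₀ (by positivity) this
  refine ⟨w, fun v => n (G.pos v), rfl, fun e => ?_, fun v hv e he => ?_⟩
  · obtain ⟨t, h0, h1⟩ := exists_unitInterval_mem_Ioo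
    obtain ⟨β, hβ⟩ := exists_isSides (G := G) e h0 h1
    let U : ℂ → ℝ := fun z => f e * β z + ∑ i ∈ Finset.univ.erase e, f i * sweep (G.arc i) z
    have hU : ContinuousAt U (G.arc e t) := by
      refine (hβ.continuousAt.const_mul _).add (tendsto_finsetSum _ fun i hi => ?_)
      refine (continuousAt_sweep ?_).const_mul _
      rintro ⟨s, hs⟩
      exact Finset.ne_of_mem_erase hi (G.arc_eq_arc h0 h1 hs.symm).1.symm
    have hWU : ∀ z, W z = U z + f e * (sweep (G.arc e) z - β z) := by
      intro z
      simp only [hW, chainSweep, U]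
      rw [← Finset.add_sum_erase _ _ (Finset.mem_univ e)]
      ring
    have hB := eventually_abs_sub_lt hU one_half_pos
    obtain ⟨z, ⟨hz1, hz2, hz3⟩, hz4⟩ := (hβ.left.and_eventually hB).exists
    obtain ⟨y, ⟨hy1, hy2, hy3⟩, hy4⟩ := (hβ.right.and_eventually hB).exists
    have ez := hw z hz1
    have ey := hw y hy1
    rw [hWU, hz2, hz3] at ez
    rw [hWU, hy2, hy3] at ey
    apply heq
    push_cast
    rw [abs_lt] at hz4 hy4 ⊢
    constructor <;> linarith
  · obtain ⟨t, h0, h1⟩ := exists_unitInterval_mem_Ioo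
    have hfe : f e = 0 := hv e he
    have hpos : ∀ i, f i ≠ 0 → G.pos v ∉ range (G.arc i) := by
      rintro i hi ⟨s, hs⟩
      rcases G.arc_mem_range_pos (hs.symm ▸ mem_range_self v : G.arc i s ∈ range G.pos) with rfl | rfl
      · rw [G.arc_zero] at hs
        exact hi (hv i (Or.inl (G.pos_injective hs)))
      · rw [G.arc_one] at hs
        exact hi (hv i (Or.inr (G.pos_injective hs)))
    have harc : ∀ s, 0 < s → s < 1 → ∀ i, f i ≠ 0 → G.arc e s ∉ range (G.arc i) := by
      rintro s hs0 hs1 i hi ⟨s', hs'⟩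
      rw [← (G.arc_eq_arc hs0 hs1 hs'.symm).1] at hi
      exact hi hfe
    have hWv : W (G.pos v) = W (G.arc e t) := by
      rcases he with rfl | rfl
      · rw [← G.arc_zero]
        refine hcl.chainSweep_eq ((isPreconnected_Icc (a := (0 : unitInterval)) (b := t)).image _
          (G.arc e).continuous.continuousOn) ?_ (mem_image_of_mem _ ⟨le_rfl, h0.le⟩)
          (mem_image_of_mem _ ⟨h0.le, le_rfl⟩)
        rintro _ ⟨s, hs, rfl⟩
        rcases eq_or_lt_of_le hs.1 with rfl | hs0
        · rw [G.arc_zero]; exact hpos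
        · exact harc s hs0 (hs.2.trans_lt h1)
      · rw [← G.arc_one]
        refine hcl.chainSweep_eq ((isPreconnected_Icc (a := t) (b := (1 : unitInterval))).image _
          (G.arc e).continuous.continuousOn) ?_ (mem_image_of_mem _ ⟨h1.le, le_rfl⟩)
          (mem_image_of_mem _ ⟨le_rfl, h1.le⟩)
        rintro _ ⟨s, hs, rfl⟩
        rcases eq_or_lt_of_le hs.2 with rfl | hs1
        · rw [G.arc_one]; exact hpos
        · exact harc s (h0.trans_le hs.1) hs1
    obtain ⟨β, hβ⟩ := exists_isSides (G := G) e h0 h1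
    obtain ⟨z, ⟨hz1, -, hz3⟩, hz4⟩ := (hβ.left.and_eventually (eventually_abs_sub_lt
      (continuousAt_chainSweep (harc t h0 h1)) one_half_pos)).exists
    apply heq
    rw [← hn _ hpos, ← hz3, ← hw z hz1, hWv]
    linarith

end PlaneGraph

section circulation

variable {X E : Type*} [Fintype E]

/-- An integral circulation on the directed graph with edges from `a e` to `b e`, tested against
potentials. -/
def IsCirculation (a b : E → X) (f : E → ℤ) : Prop :=
  ∀ φ : X → ℝ, ∑ e, (f e : ℝ) * (φ (b e) - φ (a e)) = 0

theorem IsCirculation.symm {a b : E → X} {f : E → ℤ} (h : IsCirculation a b f) :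
    IsCirculation b a f := fun φ => by
  rw [← neg_eq_zero, ← h φ, ← Finset.sum_neg_distrib]
  exact Finset.sum_congr rfl fun e _ => by ring

end circulation

/-- The indicator function of a set of edges. -/
def edgeIndicator {E : Type*} [DecidableEq E] (C : Finset E) (e : E) : ℤ := if e ∈ C then 1 else 0

theorem edgeIndicator_of_mem {E : Type*} [DecidableEq E] {C : Finset E} {e : E} (h : e ∈ C) :
    edgeIndicator C e = 1 := if_pos h

theorem edgeIndicator_of_notMem {E : Type*} [DecidableEq E] {C : Finset E} {e : E} (h : e ∉ C) :
    edgeIndicator C e = 0 := if_neg h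

theorem sum_edgeIndicator_mul {E : Type*} [Fintype E] [DecidableEq E] (C : Finset E) (g : E → ℝ) :
    ∑ e, (edgeIndicator C e : ℝ) * g e = ∑ e ∈ C, g e := by
  simp [edgeIndicator, Finset.sum_ite_mem]

section circulation

variable {X E : Type*} [Fintype E]

/-- A directed cycle, described as an elementary circulation. -/
structure IsDirectedCycle [DecidableEq E] (a b : E → X) (C : Finset E) : Prop where
  nonempty : C.Nonempty
  isCirculation : IsCirculation a b (edgeIndicator C)
  elementary : ∀ g, IsCirculation a b g → (∀ e ∉ C, g e = 0) → ∃ m, ∀ e ∈ C, g e = m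

variable [DecidableEq E] {a b : E → X} {C : Finset E}

theorem IsDirectedCycle.symm (h : IsDirectedCycle a b C) : IsDirectedCycle b a C :=
  ⟨h.nonempty, h.isCirculation.symm, fun g hg => h.elementary g hg.symm⟩

theorem IsDirectedCycle.exists_next (h : IsDirectedCycle a b C) {e : E} (he : e ∈ C) :
    ∃ e' ∈ C, a e' = b e := by
  classical
  by_contra! hcon
  have h1 := h.isCirculation fun v => if v = b e then 1 else 0
  rw [sum_edgeIndicator_mul, Finset.sum_sub_distrib,
    Finset.sum_eq_zero (fun e' he' => if_neg (hcon e' he')), sub_zero] at h1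
  have h2 := Finset.single_le_sum (f := fun e' => if b e' = b e then (1 : ℝ) else 0)
    (fun e' _ => by positivity) he
  rw [h1] at h2
  simp at h2
  linarith

theorem IsDirectedCycle.forall_ne (h : IsDirectedCycle a b C) {v : X} (hv : ∀ c ∈ C, a c ≠ v) :
    ∀ c ∈ C, b c ≠ v := fun c hc hcv => by
  obtain ⟨e', he', h'⟩ := h.exists_next hc
  exact hv e' he' (h'.trans hcv)

/-- Following chosen outgoing edges inside a finite set of vertices produces a directed cycle. -/
theorem exists_isDirectedCycle {S : Set X} (hS : S.Finite) (hne : S.Nonempty) {f : X → E}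
    (ha : ∀ v ∈ S, a (f v) = v) (hb : ∀ v ∈ S, b (f v) ∈ S) :
    ∃ C, IsDirectedCycle a b C ∧ ∀ e ∈ C, a e ∈ S ∧ f (a e) = e := by
  classical
  have hfin : {Y : Set X | Y ⊆ S ∧ Y.Nonempty ∧ ∀ v ∈ Y, b (f v) ∈ Y}.Finite :=
    hS.finite_subsets.subset fun Y hY => hY.1
  obtain ⟨Y, ⟨hYS, hYne, hYb⟩, hmin⟩ := hfin.exists_minimal ⟨S, Subset.rfl, hne, hb⟩
  have hclosed : ∀ Z : Set X, Z ⊆ Y → Z.Nonempty → (∀ v ∈ Z, b (f v) ∈ Z) → Y ⊆ Z :=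
    fun Z hZ hZne hZb => hmin ⟨hZ.trans hYS, hZne, hZb⟩ hZ
  have hYf : Y.Finite := hS.subset hYS
  set y := hYf.toFinset with hy
  have hmem : ∀ v, v ∈ y ↔ v ∈ Y := fun v => hYf.mem_toFinset
  set s : X → X := fun v => b (f v) with hs
  have himage : y.image s = y := by
    apply Finset.Subset.antisymm
    · intro v hv
      obtain ⟨u, hu, rfl⟩ := Finset.mem_image.1 hv
      exact (hmem _).2 (hYb u ((hmem u).1 hu))
    · intro v hv
      have := hclosed (s '' Y) (by rintro _ ⟨u, hu, rfl⟩; exact hYb u hu) (hYne.image s) (by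
        rintro _ ⟨u, hu, rfl⟩
        exact ⟨_, hYb u hu, rfl⟩) ((hmem v).1 hv)
      obtain ⟨u, hu, rfl⟩ := this
      exact Finset.mem_image.2 ⟨u, (hmem u).2 hu, rfl⟩
  have hsinj : InjOn s y := Finset.card_image_iff.1 (by rw [himage])
  have hfinj : InjOn f y := fun u hu v hv huv => by
    rw [← ha u (hYS ((hmem u).1 hu)), huv, ha v (hYS ((hmem v).1 hv))]
  have hsum : ∀ g : E → ℝ, ∑ e ∈ y.image f, g e = ∑ v ∈ y, g (f v) := fun g =>
    Finset.sum_image hfinj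
  have haY : ∀ v ∈ y, a (f v) = v := fun v hv => ha v (hYS ((hmem v).1 hv))
  refine ⟨y.image f, ⟨?_, fun φ => ?_, fun g hg hg0 => ?_⟩, fun e he => ?_⟩
  · obtain ⟨v, hv⟩ := hYne
    exact ⟨_, Finset.mem_image_of_mem f ((hmem v).2 hv)⟩
  · rw [sum_edgeIndicator_mul, hsum, Finset.sum_sub_distrib, sub_eq_zero]
    calc ∑ v ∈ y, φ (s v) = ∑ v ∈ y.image s, φ v := (Finset.sum_image hsinj).symm
      _ = ∑ v ∈ y, φ (a (f v)) := by
        rw [himage]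
        exact Finset.sum_congr rfl fun v hv => by rw [haY v hv]
  · have hg' : ∀ φ : X → ℝ, ∑ v ∈ y, (g (f v) : ℝ) * (φ (s v) - φ v) = 0 := by
      intro φ
      rw [← hg φ, ← Finset.sum_subset (Finset.subset_univ (y.image f)) (fun e _ he => by
        rw [hg0 e he, Int.cast_zero, zero_mul]), hsum]
      exact Finset.sum_congr rfl fun v hv => by rw [haY v hv]
    have hstep : ∀ v ∈ y, g (f (s v)) = g (f v) := by
      intro v hv
      have hsv : s v ∈ y := himage ▸ Finset.mem_image_of_mem s hv
      have h1 := hg' fun x => if x = s v then 1 else 0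
      simp only [mul_sub, mul_ite, mul_one, mul_zero, Finset.sum_sub_distrib,
        Finset.sum_ite_eq', hsv, if_true] at h1
      rw [Finset.sum_eq_single_of_mem v hv (fun u hu huv => if_neg fun h => huv (hsinj hu hv h)),
        if_pos rfl, sub_eq_zero] at h1
      exact_mod_cast h1.symm
    obtain ⟨v₀, hv₀⟩ := hYne
    refine ⟨g (f v₀), fun e he => ?_⟩
    obtain ⟨v, hv, rfl⟩ := Finset.mem_image.1 he
    exact (hclosed {v | v ∈ Y ∧ g (f v) = g (f v₀)} (fun v hv => hv.1) ⟨v₀, hv₀, rfl⟩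
      (fun v hv => ⟨hYb v hv.1, (hstep v ((hmem v).2 hv.1)).trans hv.2⟩) ((hmem v).1 hv)).2
  · obtain ⟨v, hv, rfl⟩ := Finset.mem_image.1 he
    rw [haY v hv]
    exact ⟨hYS ((hmem v).1 hv), rfl⟩

/-- If a directed cycle cannot be modified using edges on which `ω` does not vanish, then `ω`
vanishes on all edges which leave the cycle. Here `ω` is determined by the endpoints of an edge off
the cycle. -/
theorem IsDirectedCycle.eq_zero_of_leaves [Finite X] (hC : IsDirectedCycle a b C) {ω : E → ℤ}
    {u : X → ℤ} (hu : ∀ v, (∀ c ∈ C, a c ≠ v) → ∀ e, a e = v ∨ b e = v → ω e = u v)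
    (hout : ∀ v, (∀ c ∈ C, a c ≠ v) → ∀ e, b e = v → ω e ≠ 0 → ∃ e, a e = v)
    (hmin : ∀ C', IsDirectedCycle a b C' → (∀ e ∈ C', e ∈ C ∨ ω e ≠ 0) → C' ⊆ C)
    {e : E} (heC : e ∉ C) (he : ∃ c ∈ C, a c = a e) : ω e = 0 := by
  classical
  by_contra hω
  let f : X → E := fun v => if v = a e then e else if h : ∃ c ∈ C, a c = v then h.choose else
    if h : ∃ e, a e = v then h.choose else e
  have hfe : f (a e) = e := if_pos rfl
  have hfC : ∀ v, v ≠ a e → (∃ c ∈ C, a c = v) → f v ∈ C ∧ a (f v) = v := by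
    intro v hv h
    have : f v = h.choose := by simp only [f, if_neg hv, dif_pos h]
    rw [this]; exact h.choose_spec
  have hfo : ∀ v, ¬ (∃ c ∈ C, a c = v) → (∃ e, a e = v) → a (f v) = v := by
    intro v hv h
    have hne : v ≠ a e := fun h => hv (h ▸ he)
    have : f v = h.choose := by simp only [f, if_neg hne, dif_neg hv, dif_pos h]
    rw [this]; exact h.choose_spec
  have hdich : ∀ v, (∃ c ∈ C, a c = v) ∨ ∀ c ∈ C, a c ≠ v := fun v => by
    by_cases h : ∃ c ∈ C, a c = v
    · exact Or.inl h
    · right; push Not at h; exact h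
  let S : Set X := {v | (∃ c ∈ C, a c = v) ∨ (∃ e, a e = v) ∧ u v ≠ 0}
  have hbS : ∀ e', ω e' ≠ 0 → b e' ∈ S := by
    intro e' he'
    rcases hdich (b e') with h | h
    · exact Or.inl h
    · exact Or.inr ⟨hout _ h e' rfl he', by rwa [← hu _ h e' (Or.inr rfl)]⟩
  have hf : ∀ v ∈ S, a (f v) = v ∧ (f v ∈ C ∨ ω (f v) ≠ 0) := by
    intro v hv
    by_cases hve : v = a e
    · rw [hve, hfe]; exact ⟨rfl, Or.inr hω⟩
    rcases hdich v with h | h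
    · have := hfC v hve h
      exact ⟨this.2, Or.inl this.1⟩
    · have hnot : ¬ ∃ c ∈ C, a c = v := by push Not; exact h
      have hv' := hv.resolve_left hnot
      have h2 := hfo v hnot hv'.1
      exact ⟨h2, Or.inr (by rw [hu v h _ (Or.inl h2)]; exact hv'.2)⟩
  obtain ⟨C', hC', hC'f⟩ := exists_isDirectedCycle (a := a) (b := b) (toFinite S)
    ⟨a e, Or.inl he⟩ (fun v hv => (hf v hv).1) fun v hv => by
      rcases (hf v hv).2 with h | h
      · exact Or.inl (hC.exists_next h)
      · exact hbS _ h
  have hsub := hmin C' hC' fun e' he' => by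
    have := (hf _ (hC'f e' he').1).2
    rwa [(hC'f e' he').2] at this
  obtain ⟨m, hm⟩ := hC.elementary _ hC'.isCirculation fun e' he' =>
    edgeIndicator_of_notMem fun h => he' (hsub h)
  obtain ⟨c', hc'⟩ := hC'.nonempty
  obtain ⟨c, hc, hce⟩ := he
  have h1 := hm c' (hsub hc')
  rw [edgeIndicator_of_mem hc'] at h1
  have hcC' : c ∈ C' := by
    by_contra h
    have h2 := hm c hc
    rw [edgeIndicator_of_notMem h, ← h1] at h2
    exact zero_ne_one h2
  have h3 := (hC'f c hcC').2
  rw [hce, hfe] at h3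
  exact heC (h3 ▸ hc)

end circulation

namespace PlaneGraph

variable {V E : Type*} {G : PlaneGraph V E}

theorem IsWalk.append {x y z : V} {l m : List E} (hl : G.IsWalk x l y) (hm : G.IsWalk y m z) :
    G.IsWalk x (l ++ m) z := by
  induction l generalizing x with
  | nil => cases hl; exact hm
  | cons e l ih => exact ⟨hl.1, ih hl.2⟩

theorem IsWalk.exists_of_append {x z : V} {l m : List E} (h : G.IsWalk x (l ++ m) z) :
    ∃ y, G.IsWalk x l y ∧ G.IsWalk y m z := by
  induction l generalizing x with
  | nil => exact ⟨x, rfl, h⟩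
  | cons e l ih =>
    obtain ⟨y, h1, h2⟩ := ih h.2
    exact ⟨y, ⟨h.1, h1⟩, h2⟩

theorem IsWalk.right_unique {x y z : V} {l : List E} (hl : G.IsWalk x l y) (hm : G.IsWalk x l z) :
    y = z := by
  induction l generalizing x with
  | nil => exact hl.symm.trans hm
  | cons e l ih => exact ih hl.2 hm.2

theorem IsWalk.tgt_eq_or {x y : V} {l : List E} (h : G.IsWalk x l y) {e : E} (he : e ∈ l) :
    G.tgt e = y ∨ ∃ e' ∈ l, G.src e' = G.tgt e := by
  induction l generalizing x with
  | nil => simp at he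
  | cons e₀ l ih =>
    rcases List.mem_cons.1 he with rfl | he
    · cases l with
      | nil => exact Or.inl h.2
      | cons e₁ l => exact Or.inr ⟨e₁, by simp, h.2.1⟩
    · rcases ih h.2 he with h' | ⟨e', he', h'⟩
      exacts [Or.inl h', Or.inr ⟨e', List.mem_cons_of_mem _ he', h'⟩]

theorem IsWalk.exists_src_eq {x y : V} {l : List E} (h : G.IsWalk x l y) (hne : l ≠ []) :
    ∃ e ∈ l, G.src e = x := by
  cases l with
  | nil => exact absurd rfl hne
  | cons e l => exact ⟨e, by simp, h.1⟩

theorem IsWalk.exists_tgt_eq {x y : V} {l : List E} (h : G.IsWalk x l y) (hne : l ≠ []) :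
    ∃ e ∈ l, G.tgt e = y := by
  induction l generalizing x with
  | nil => exact absurd rfl hne
  | cons e l ih =>
    cases l with
    | nil => exact ⟨e, by simp, h.2⟩
    | cons e' l =>
      obtain ⟨e₁, he₁, h₁⟩ := ih h.2 (by simp)
      exact ⟨e₁, List.mem_cons_of_mem _ he₁, h₁⟩

theorem IsWalk.exists_split {x y v : V} {l : List E} (h : G.IsWalk x l y)
    (hv : v ∈ x :: l.map G.tgt) : ∃ l₁ l₂, l = l₁ ++ l₂ ∧ G.IsWalk x l₁ v := by
  induction l generalizing x with
  | nil =>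
    simp only [List.map_nil, List.mem_singleton] at hv
    exact ⟨[], [], rfl, hv.symm⟩
  | cons e l ih =>
    rcases List.mem_cons.1 hv with rfl | hv
    · exact ⟨[], e :: l, rfl, rfl⟩
    · obtain ⟨l₁, l₂, rfl, h₁⟩ := ih h.2 (by simpa using hv)
      exact ⟨e :: l₁, l₂, rfl, h.1, h₁⟩

theorem IsWalk.sum_map {x y : V} {l : List E} (h : G.IsWalk x l y) (φ : V → ℝ) :
    (l.map fun e => φ (G.tgt e) - φ (G.src e)).sum = φ y - φ x := by
  induction l generalizing x with
  | nil => cases h; simp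
  | cons e l ih =>
    rw [List.map_cons, List.sum_cons, ih h.2, h.1]; ring

theorem IsPath.nodup {x y : V} {l : List E} (h : G.IsPath x l y) : l.Nodup :=
  (List.nodup_cons.1 h.2).2.of_map

theorem IsPath.of_cons {x y : V} {e : E} {l : List E} (h : G.IsPath x (e :: l) y) :
    G.IsPath (G.tgt e) l y :=
  ⟨h.1.2, (List.nodup_cons.1 h.2).2⟩

theorem IsWalk.src_mem {x y : V} {l : List E} (h : G.IsWalk x l y) {e : E} (he : e ∈ l) :
    G.src e ∈ x :: l.map G.tgt := by
  induction l generalizing x with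
  | nil => simp at he
  | cons e₀ l ih =>
    rcases List.mem_cons.1 he with rfl | he
    · simp [h.1]
    · exact List.mem_cons_of_mem _ (ih h.2 he)

theorem IsPath.eq_of_src_eq {x y : V} {l : List E} (h : G.IsPath x l y) {e e' : E} (he : e ∈ l)
    (he' : e' ∈ l) (hee : G.src e = G.src e') : e = e' := by
  induction l generalizing x with
  | nil => simp at he
  | cons e₀ l ih =>
    have hx : ∀ e ∈ l, G.src e ≠ G.src e₀ := fun e he h' => by
      have h2 := h.1.2.src_mem he
      rw [h', h.1.1] at h2
      exact (List.nodup_cons.1 h.2).1 h2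
    rcases List.mem_cons.1 he with h1 | h1 <;> rcases List.mem_cons.1 he' with h2 | h2
    · rw [h1, h2]
    · exact absurd (h1 ▸ hee).symm (hx e' h2)
    · exact absurd (h2 ▸ hee) (hx e h1)
    · exact ih h.of_cons h1 h2

theorem IsPath.src_ne {x y : V} {l : List E} (h : G.IsPath x l y) {e : E} (he : e ∈ l) :
    G.src e ≠ y := by
  induction l generalizing x with
  | nil => simp at he
  | cons e₀ l ih =>
    rcases List.mem_cons.1 he with rfl | he
    · rw [h.1.1]
      rintro rfl
      obtain ⟨e', he', h'⟩ := h.1.exists_tgt_eq (by simp)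
      exact (List.nodup_cons.1 h.2).1 (List.mem_map.2 ⟨e', he', h'⟩)
    · exact ih h.of_cons he

theorem IsWalk.prefix_of_subset {s t x y : V} {l p m : List E} (hm : G.IsPath s (p ++ m) t)
    (hp : G.IsWalk s p x) (hl : G.IsWalk x l y) (h : ∀ e ∈ l, e ∈ p ++ m) : l <+: m := by
  induction l generalizing x p m with
  | nil => exact List.nil_prefix
  | cons e l ih =>
    obtain ⟨x', hp', hmw⟩ := hm.1.exists_of_append
    obtain rfl := hp.right_unique hp'
    cases m with
    | nil =>
      cases hmw
      exact absurd hl.1 (hm.src_ne (h e (by simp)))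
    | cons e₂ m =>
      have hee : e = e₂ := hm.eq_of_src_eq (h e (by simp)) (by simp) (hl.1.trans hmw.1.symm)
      subst hee
      rw [List.prefix_cons_inj]
      refine ih (p := p ++ [e]) (by simpa using hm) (hp.append ⟨hl.1, rfl⟩) hl.2 fun e' he' => ?_
      simpa using h e' (List.mem_cons_of_mem _ he')

/-- A nonempty walk whose edges all lie on a path is a segment of that path. -/
theorem IsWalk.exists_eq_append {x y s t : V} {l m : List E} (hne : l ≠ []) (hl : G.IsWalk x l y)
    (hm : G.IsPath s m t) (h : ∀ e ∈ l, e ∈ m) :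
    ∃ p q, m = p ++ l ++ q ∧ G.IsWalk s p x ∧ G.IsWalk y q t := by
  obtain ⟨e, he, hex⟩ := hl.exists_src_eq hne
  have hxm := hm.1.src_mem (h e he)
  rw [hex] at hxm
  obtain ⟨p, m', rfl, hp⟩ := hm.1.exists_split hxm
  obtain ⟨q, rfl⟩ := IsWalk.prefix_of_subset hm hp hl h
  obtain ⟨x', hp', hm'⟩ := hm.1.exists_of_append
  obtain rfl := hp.right_unique hp'
  obtain ⟨y', hl', hq⟩ := hm'.exists_of_append
  obtain rfl := hl.right_unique hl'
  exact ⟨p, q, by simp, hp, hq⟩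

theorem IsPath.eq_of_subset {s t : V} {l m : List E} (hl : G.IsPath s l t) (hm : G.IsPath s m t)
    (hlm : ∀ e ∈ l, e ∈ m) (hml : ∀ e ∈ m, e ∈ l) : l = m := by
  have h1 := IsWalk.prefix_of_subset (p := []) hm rfl hl.1 hlm
  have h2 := IsWalk.prefix_of_subset (p := []) hl rfl hm.1 hml
  exact h1.eq_of_length_le h2.length_le

end PlaneGraph

namespace PlaneGraph

variable {V E : Type*} {G : PlaneGraph V E}

theorem IsPath.sum_eq [Fintype E] {x y : V} {l : List E} (hl : G.IsPath x l y) {p : E → Prop}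
    [DecidablePred p] (h : ∀ e, e ∈ l ↔ p e) (φ : V → ℝ) :
    ∑ e with p e, (φ (G.tgt e) - φ (G.src e)) = φ y - φ x := by
  classical
  rw [← hl.1.sum_map φ, ← List.sum_toFinset _ hl.nodup]
  exact Finset.sum_congr (by ext e; simp [h]) fun _ _ => rfl

theorem IsWalk.sum_count_mul [Fintype E] [DecidableEq E] {x y : V} {l : List E}
    (hl : G.IsWalk x l y) (φ : V → ℝ) :
    ∑ e, (l.count e : ℝ) * (φ (G.tgt e) - φ (G.src e)) = φ y - φ x := by
  rw [← hl.sum_map φ, Finset.sum_list_map_count]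
  simp only [nsmul_eq_mul]
  refine (Finset.sum_subset (Finset.subset_univ _) fun e _ he => ?_).symm
  rw [List.count_eq_zero_of_not_mem (by simpa using he), Nat.cast_zero, zero_mul]

theorem IsWalk.isCirculation_count_sub [Fintype E] [DecidableEq E] {x y : V} {l m : List E}
    (hl : G.IsWalk x l y) (hm : G.IsWalk x m y) :
    IsCirculation G.src G.tgt fun e => (l.count e : ℤ) - m.count e := fun φ => by
  push_cast
  simp only [sub_mul, Finset.sum_sub_distrib]
  rw [hl.sum_count_mul, hm.sum_count_mul, sub_self]

end PlaneGraph

open PlaneGraph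

namespace PastingScheme

variable {V E : Type*} (P : PastingScheme V E)

theorem mem_cellDom {α : P.TwoCell} {e : E} : e ∈ P.cellDom α ↔ P.rightFace e = some α :=
  ((P.interior α).mem_dom e).trans (onRight_iff fun _ => mem_interiorFace_iff)

theorem mem_cellCod {α : P.TwoCell} {e : E} : e ∈ P.cellCod α ↔ P.leftFace e = some α :=
  ((P.interior α).mem_cod e).trans (onLeft_iff fun _ => mem_interiorFace_iff)

theorem mem_dom {e : E} : e ∈ P.dom ↔ P.leftFace e = none :=
  (P.exterior.mem_dom e).trans (onLeft_iff fun _ => mem_exteriorFace_iff)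

theorem mem_cod {e : E} : e ∈ P.cod ↔ P.rightFace e = none :=
  (P.exterior.mem_cod e).trans (onRight_iff fun _ => mem_exteriorFace_iff)

theorem cellDom_isPath (α : P.TwoCell) : P.IsPath (P.cellSource α) (P.cellDom α) (P.cellTarget α) :=
  (P.interior α).dom_isPath

theorem cellCod_isPath (α : P.TwoCell) : P.IsPath (P.cellSource α) (P.cellCod α) (P.cellTarget α) :=
  (P.interior α).cod_isPath

theorem dom_isPath : P.IsPath P.s P.dom P.t := P.exterior.dom_isPath

theorem cod_isPath : P.IsPath P.s P.cod P.t := P.exterior.cod_isPath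

theorem cellDom_ne_nil (α : P.TwoCell) : P.cellDom α ≠ [] := (P.interior α).dom_ne_nil

theorem cellCod_ne_nil (α : P.TwoCell) : P.cellCod α ≠ [] := (P.interior α).cod_ne_nil

theorem exists_rightFace_eq (α : P.TwoCell) : ∃ e, P.rightFace e = some α := by
  obtain ⟨e, he⟩ := List.exists_mem_of_ne_nil _ (P.cellDom_ne_nil α)
  exact ⟨e, P.mem_cellDom.1 he⟩

theorem exists_leftFace_eq (α : P.TwoCell) : ∃ e, P.leftFace e = some α := by
  obtain ⟨e, he⟩ := List.exists_mem_of_ne_nil _ (P.cellCod_ne_nil α)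
  exact ⟨e, P.mem_cellCod.1 he⟩

theorem finite_twoCell : Finite P.TwoCell := by
  have := P.finite_edges
  choose f hf using P.exists_rightFace_eq
  exact Finite.of_injective f fun α β h => Option.some.inj ((hf α).symm.trans (h ▸ hf β))

theorem isCirculation_jump [Fintype E] (g : Option P.TwoCell → ℤ) :
    IsCirculation P.src P.tgt fun e => g (P.leftFace e) - g (P.rightFace e) := by
  classical
  have := P.finite_twoCell
  have := Fintype.ofFinite P.TwoCell
  intro φ
  push_cast
  simp only [sub_mul, Finset.sum_sub_distrib, sub_eq_zero]
  rw [← Finset.sum_fiberwise (s := Finset.univ) (g := P.leftFace),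
    ← Finset.sum_fiberwise (s := Finset.univ) (g := P.rightFace)]
  refine Finset.sum_congr rfl fun F _ => ?_
  have h1 : ∀ (k : E → Option P.TwoCell), ∑ e with k e = F,
      (g (k e) : ℝ) * (φ (P.tgt e) - φ (P.src e)) =
      g F * ∑ e with k e = F, (φ (P.tgt e) - φ (P.src e)) := fun k => by
    rw [Finset.mul_sum]
    exact Finset.sum_congr rfl fun e he => by rw [(Finset.mem_filter.1 he).2]
  rw [h1, h1]
  congr 1
  cases F with
  | none => rw [P.dom_isPath.sum_eq fun e => P.mem_dom, P.cod_isPath.sum_eq fun e => P.mem_cod]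
  | some α =>
    rw [(P.cellCod_isPath α).sum_eq fun e => P.mem_cellCod,
      (P.cellDom_isPath α).sum_eq fun e => P.mem_cellDom]

section cycle

variable [Fintype E] [DecidableEq E] {C : Finset E} {w : Option P.TwoCell → ℤ}

/-- A function of the faces which jumps only along a directed cycle is a multiple of the winding
number of the cycle. -/
theorem exists_eq_mul_winding (hC : IsDirectedCycle P.src P.tgt C) (hw0 : w none = 0)
    (hw : ∀ e, w (P.leftFace e) - w (P.rightFace e) = edgeIndicator C e)
    {g : Option P.TwoCell → ℤ} (hg0 : g none = 0)
    (hg : ∀ e ∉ C, g (P.leftFace e) = g (P.rightFace e)) : ∃ m, ∀ F, g F = m * w F := by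
  obtain ⟨m, hm⟩ := hC.elementary _ (P.isCirculation_jump g) fun e he => sub_eq_zero.2 (hg e he)
  refine ⟨m, fun F => ?_⟩
  have h := eq_of_leftFace_eq_rightFace (G := P.toPlaneGraph) (g := fun F => g F - m * w F)
    (fun e => ?_) F none
  · simp only [hg0, hw0, mul_zero, sub_zero] at h
    exact sub_eq_zero.1 h
  · have h2 := hw e
    by_cases he : e ∈ C
    · rw [edgeIndicator_of_mem he] at h2
      have h3 := hm e he
      linear_combination h3 - m * h2
    · rw [edgeIndicator_of_notMem he] at h2
      linear_combination hg e he - m * h2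

theorem winding_support_ssubset [Fintype P.TwoCell] (hC : IsDirectedCycle P.src P.tgt C)
    (hw0 : w none = 0) (hw : ∀ e, w (P.leftFace e) - w (P.rightFace e) = edgeIndicator C e)
    {C' : Finset E} {w' : Option P.TwoCell → ℤ} (hC' : IsDirectedCycle P.src P.tgt C')
    (hw0' : w' none = 0)
    (hw' : ∀ e, w' (P.leftFace e) - w' (P.rightFace e) = edgeIndicator C' e)
    (hCC' : ∀ e ∈ C', e ∈ C ∨ w (P.leftFace e) ≠ 0) (hne : ¬ C' ⊆ C) :
    Finset.univ.filter (fun F => w' F ≠ 0) ⊂ Finset.univ.filter (fun F => w F ≠ 0) := by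
  have hoff : ∀ {w : Option P.TwoCell → ℤ} {C : Finset E},
      (∀ e, w (P.leftFace e) - w (P.rightFace e) = edgeIndicator C e) → ∀ e ∉ C,
      w (P.leftFace e) = w (P.rightFace e) := fun hw e he =>
    sub_eq_zero.1 ((hw e).trans (edgeIndicator_of_notMem he))
  rw [Finset.ssubset_iff_subset_ne]
  constructor
  · obtain ⟨m, hm⟩ := P.exists_eq_mul_winding hC hw0 hw (g := fun F => if w F = 0 then w' F else 0)
      (by simp [hw0']) fun e he => by
        simp only [← hoff hw e he]
        split_ifs with h
        · by_cases he' : e ∈ C'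
          · exact absurd h ((hCC' e he').resolve_left he)
          · exact hoff hw' e he'
        · rfl
    intro F hF
    simp only [Finset.mem_filter, Finset.mem_univ, true_and] at hF ⊢
    intro h0
    have := hm F
    rw [if_pos h0, h0, mul_zero] at this
    exact hF this
  · intro heq
    have heq' : ∀ F, w' F = 0 ↔ w F = 0 := fun F => by
      have := Finset.ext_iff.1 heq F
      simp only [Finset.mem_filter, Finset.mem_univ, true_and] at this
      exact not_iff_not.1 this
    obtain ⟨m, hm⟩ := P.exists_eq_mul_winding hC hw0 hw (g := fun F => if w F = 0 then 0 else 1)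
      (by simp [hw0]) fun e he => by simp only [hoff hw e he]
    obtain ⟨m', hm'⟩ := P.exists_eq_mul_winding hC' hw0' hw'
      (g := fun F => if w' F = 0 then 0 else 1) (by simp [hw0']) fun e he => by
        simp only [hoff hw' e he]
    obtain ⟨e₀, he₀', he₀⟩ := Finset.not_subset.1 hne
    have h1 : m' = 0 := by
      have ha := hm' (P.leftFace e₀)
      have hb := hm' (P.rightFace e₀)
      simp only [heq', hm, hoff hw e₀ he₀] at ha hb
      have h2 := hw' e₀
      rw [edgeIndicator_of_mem he₀'] at h2
      linear_combination hb - ha - m' * h2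
    have h3 : ∀ F, w' F = 0 := fun F => by
      by_contra h
      have := hm' F
      rw [if_neg h, h1, zero_mul] at this
      exact one_ne_zero this
    have h2 := hw' e₀
    rw [edgeIndicator_of_mem he₀', h3, h3] at h2
    simp at h2

theorem exists_winding_of_cycle (hC : IsDirectedCycle P.src P.tgt C) :
    ∃ (w : Option P.TwoCell → ℤ) (u : V → ℤ), w none = 0 ∧
      (∀ e, w (P.leftFace e) - w (P.rightFace e) = edgeIndicator C e) ∧
      ∀ v, (∀ c ∈ C, P.src c ≠ v) → ∀ e, P.src e = v ∨ P.tgt e = v → w (P.leftFace e) = u v := by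
  obtain ⟨w, u, h0, h1, h2⟩ := exists_winding (G := P.toPlaneGraph) _ hC.isCirculation
  refine ⟨w, u, h0, h1, fun v hv => h2 v fun e he => edgeIndicator_of_notMem fun heC => ?_⟩
  rcases he with he | he
  exacts [hv e heC he, hC.forall_ne hv e heC he]

theorem false_of_winding_eq_zero (hC : IsDirectedCycle P.src P.tgt C) (hw0 : w none = 0)
    (hw : ∀ e, w (P.leftFace e) - w (P.rightFace e) = edgeIndicator C e)
    (h : ∀ e ∉ C, w (P.leftFace e) = 0) : False := by
  have := P.finite_twoCell
  have hR : ∀ e ∉ C, w (P.rightFace e) = 0 := fun e he => by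
    have := hw e
    rw [edgeIndicator_of_notMem he, h e he] at this
    linarith
  obtain ⟨F, hF⟩ := Finite.exists_max w
  obtain ⟨F', hF'⟩ := Finite.exists_min w
  have hle : w F ≤ 0 := by
    cases F with
    | none => rw [hw0]
    | some α =>
      obtain ⟨e, he⟩ := P.exists_rightFace_eq α
      by_cases heC : e ∈ C
      · have := hw e
        rw [edgeIndicator_of_mem heC, he] at this
        linarith [hF (P.leftFace e)]
      · rw [← he, hR e heC]
  have hge : 0 ≤ w F' := by
    cases F' with
    | none => rw [hw0]
    | some α =>
      obtain ⟨e, he⟩ := P.exists_leftFace_eq α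
      by_cases heC : e ∈ C
      · have := hw e
        rw [edgeIndicator_of_mem heC, he] at this
        linarith [hF' (P.rightFace e)]
      · rw [← he, h e heC]
  obtain ⟨c, hc⟩ := hC.nonempty
  have := hw c
  rw [edgeIndicator_of_mem hc] at this
  linarith [hF (P.leftFace c), hF' (P.rightFace c)]

/-- A pasting scheme has no directed cycles. -/
theorem not_isDirectedCycle (C : Finset E) : ¬ IsDirectedCycle P.src P.tgt C := by
  have := P.finite_twoCell
  have := Fintype.ofFinite P.TwoCell
  have := P.finite_vertices
  suffices H : ∀ (n : ℕ) (C : Finset E) (w : Option P.TwoCell → ℤ) (u : V → ℤ),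
      IsDirectedCycle P.src P.tgt C → w none = 0 →
      (∀ e, w (P.leftFace e) - w (P.rightFace e) = edgeIndicator C e) →
      (∀ v, (∀ c ∈ C, P.src c ≠ v) → ∀ e, P.src e = v ∨ P.tgt e = v → w (P.leftFace e) = u v) →
      (Finset.univ.filter (fun F => w F ≠ 0)).card = n → False by
    intro hC
    obtain ⟨w, u, h0, h1, h2⟩ := P.exists_winding_of_cycle hC
    exact H _ C w u hC h0 h1 h2 rfl
  intro n
  induction n using Nat.strong_induction_on with
  | _ n ih =>
  intro C w u hC hw0 hw hu hn
  have hmin : ∀ C', IsDirectedCycle P.src P.tgt C' →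
      (∀ e ∈ C', e ∈ C ∨ w (P.leftFace e) ≠ 0) → C' ⊆ C := by
    intro C' hC' hCC'
    by_contra hne
    obtain ⟨w', u', h0', h1', h2'⟩ := P.exists_winding_of_cycle hC'
    exact ih _ (hn ▸ Finset.card_lt_card (P.winding_support_ssubset hC hw0 hw hC' h0' h1' hCC' hne))
      C' w' u' hC' h0' h1' h2' rfl
  have hu' : ∀ v, (∀ c ∈ C, P.tgt c ≠ v) → ∀ e, P.tgt e = v ∨ P.src e = v →
      w (P.leftFace e) = u v := fun v hv e he => hu v (hC.symm.forall_ne hv) e he.symm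
  have hdom : ∀ v, (∀ c ∈ C, P.src c ≠ v) → (∃ e ∈ P.dom, P.src e = v ∨ P.tgt e = v) →
      u v = 0 := by
    rintro v hv ⟨e, he, hev⟩
    rw [← hu v hv e hev, P.mem_dom.1 he, hw0]
  have hdne : P.dom ≠ [] := P.exterior.dom_ne_nil
  have hfor : ∀ e ∉ C, (∃ c ∈ C, P.src c = P.src e) → w (P.leftFace e) = 0 := fun e =>
    hC.eq_zero_of_leaves (ω := fun e => w (P.leftFace e)) hu (fun v hv e hev hne => by
      by_contra hcon
      push Not at hcon
      have hvt : v = P.t := (P.isLocalSink_iff v).1 hcon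
      obtain ⟨e', he', h'⟩ := P.dom_isPath.1.exists_tgt_eq hdne
      exact hne ((hu v hv e (Or.inr hev)).trans (hdom v hv ⟨e', he', Or.inr (h'.trans hvt.symm)⟩)))
      hmin
  have hback : ∀ e ∉ C, (∃ c ∈ C, P.tgt c = P.tgt e) → w (P.leftFace e) = 0 := fun e =>
    hC.symm.eq_zero_of_leaves (ω := fun e => w (P.leftFace e)) hu' (fun v hv e hev hne => by
      by_contra hcon
      push Not at hcon
      have hvs : v = P.s := (P.isLocalSource_iff v).1 hcon
      obtain ⟨e', he', h'⟩ := P.dom_isPath.1.exists_src_eq hdne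
      exact hne ((hu' v hv e (Or.inr hev)).trans (hdom v (hC.symm.forall_ne hv)
        ⟨e', he', Or.inl (h'.trans hvs.symm)⟩)))
      fun C' hC' h => hmin C' hC'.symm h
  let K : V → Prop := fun v => (∃ c ∈ C, P.src c = v) ∨
    ∀ e, P.src e = v ∨ P.tgt e = v → w (P.leftFace e) = 0
  have hK : ∀ v e, (P.src e = v ∨ P.tgt e = v) → w (P.leftFace e) = 0 → K v := by
    intro v e hev he
    by_cases hv : ∃ c ∈ C, P.src c = v
    · exact Or.inl hv
    · push Not at hv
      exact Or.inr fun e' he' => by rw [hu v hv e' he', ← hu v hv e hev, he]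
  have hstep : ∀ e, K (P.src e) ↔ K (P.tgt e) := by
    intro e
    by_cases heC : e ∈ C
    · exact ⟨fun _ => Or.inl (hC.exists_next heC), fun _ => Or.inl ⟨e, heC, rfl⟩⟩
    constructor
    · rintro (h | h)
      · exact hK _ e (Or.inr rfl) (hfor e heC h)
      · exact hK _ e (Or.inr rfl) (h e (Or.inl rfl))
    · rintro (⟨c, hc, hce⟩ | h)
      · obtain ⟨c', hc', h'⟩ := hC.symm.exists_next hc
        exact hK _ e (Or.inl rfl) (hback e heC ⟨c', hc', h'.trans hce⟩)
      · exact hK _ e (Or.inl rfl) (h e (Or.inr rfl))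
  have hconn : ∀ x y, Relation.EqvGen (fun a b => ∃ e, P.src e = a ∧ P.tgt e = b) x y →
      (K x ↔ K y) := by
    intro x y h
    induction h with
    | rel x y h => obtain ⟨e, rfl, rfl⟩ := h; exact hstep e
    | refl x => rfl
    | symm x y _ ih => exact ih.symm
    | trans x y z _ _ ih1 ih2 => exact ih1.trans ih2
  obtain ⟨c, hc⟩ := hC.nonempty
  refine P.false_of_winding_eq_zero hC hw0 hw fun e he => ?_
  rcases (hconn (P.src c) (P.src e) (P.connected _ _)).1 (Or.inl ⟨c, hc, rfl⟩) with h | h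
  · exact hfor e he h
  · exact h e (Or.inl rfl)

end cycle

theorem eq_nil_of_isWalk_self {v : V} {l : List E} (h : P.IsWalk v l v) : l = [] := by
  classical
  by_contra hne
  have := P.finite_vertices
  have := P.finite_edges
  have := Fintype.ofFinite E
  let S : Set V := {x | ∃ e ∈ l, P.src e = x}
  have : Nonempty E := ⟨l.head hne⟩
  choose! f hf using fun (x : V) (hx : x ∈ S) => hx
  obtain ⟨C, hC, -⟩ := exists_isDirectedCycle (a := P.src) (b := P.tgt) (toFinite S)
    ⟨v, h.exists_src_eq hne⟩ (fun x hx => (hf x hx).2) fun x hx => by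
      rcases h.tgt_eq_or (hf x hx).1 with h' | h'
      · rw [h']; exact h.exists_src_eq hne
      · exact h'
  exact P.not_isDirectedCycle C hC

theorem isPath_of_isWalk {x y : V} {l : List E} (h : P.IsWalk x l y) : P.IsPath x l y := by
  refine ⟨h, ?_⟩
  induction l generalizing x with
  | nil => simp
  | cons e l ih =>
    rw [List.map_cons, List.nodup_cons]
    refine ⟨fun hx => ?_, ih h.2⟩
    obtain ⟨l₁, l₂, -, h₁⟩ := h.2.exists_split hx
    exact List.cons_ne_nil e l₁ (P.eq_nil_of_isWalk_self (l := e :: l₁) ⟨h.1, h₁⟩)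

theorem exists_isWalk_to_t (v : V) : ∃ l, P.IsWalk v l P.t := by
  classical
  by_contra hcon
  have := P.finite_vertices
  have := P.finite_edges
  have := Fintype.ofFinite E
  let S : Set V := {x | ¬ ∃ l, P.IsWalk x l P.t}
  have hS : ∀ x ∈ S, ∃ e, P.src e = x := by
    intro x hx
    by_contra! h
    exact hx ⟨[], (P.isLocalSink_iff x).1 h⟩
  have : Nonempty E := ⟨(hS v hcon).choose⟩
  choose! f hf using hS
  obtain ⟨C, hC, -⟩ := exists_isDirectedCycle (a := P.src) (b := P.tgt) (toFinite S)
    ⟨v, hcon⟩ hf fun x hx => by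
      rintro ⟨l, hl⟩
      exact hx ⟨f x :: l, hf x hx, hl⟩
  exact P.not_isDirectedCycle C hC

theorem exists_isWalk_from_s (v : V) : ∃ l, P.IsWalk P.s l v := by
  classical
  by_contra hcon
  have := P.finite_vertices
  have := P.finite_edges
  have := Fintype.ofFinite E
  let S : Set V := {x | ¬ ∃ l, P.IsWalk P.s l x}
  have hS : ∀ x ∈ S, ∃ e, P.tgt e = x := by
    intro x hx
    by_contra! h
    exact hx ⟨[], ((P.isLocalSource_iff x).1 h).symm⟩
  have : Nonempty E := ⟨(hS v hcon).choose⟩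
  choose! f hf using hS
  obtain ⟨C, hC, -⟩ := exists_isDirectedCycle (a := P.tgt) (b := P.src) (toFinite S)
    ⟨v, hcon⟩ hf fun x hx => by
      rintro ⟨l, hl⟩
      exact hx ⟨l ++ [f x], hl.append ⟨rfl, hf x hx⟩⟩
  exact P.not_isDirectedCycle C hC.symm

/-- Every nonempty set of atomic 2-cells has an uppermost member. -/
theorem exists_uppermost (S : Finset P.TwoCell) (hS : S.Nonempty) :
    ∃ α ∈ S, ∀ e ∈ P.cellDom α, ∀ β ∈ S, P.leftFace e ≠ some β := by
  classical
  by_contra! hcon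
  have := P.finite_edges
  have := Fintype.ofFinite E
  have := P.finite_twoCell
  obtain ⟨α₀, hα₀⟩ := hS
  have : Nonempty E := ⟨(hcon α₀ hα₀).choose⟩
  choose! f hf hfβ using hcon
  obtain ⟨D, hD, hDf⟩ := exists_isDirectedCycle (a := P.rightFace) (b := P.leftFace)
    (f := fun F => F.elim (f α₀) f) (toFinite (some '' (S : Set P.TwoCell)))
    ⟨_, mem_image_of_mem _ hα₀⟩ (by
      rintro _ ⟨α, hα, rfl⟩
      exact P.mem_cellDom.1 (hf α hα)) (by
      rintro _ ⟨α, hα, rfl⟩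
      obtain ⟨β, hβ, h⟩ := hfβ α hα
      exact ⟨β, hβ, h.symm⟩)
  obtain ⟨e₀, he₀⟩ := hD.nonempty
  obtain ⟨l, hl⟩ := P.exists_isWalk_from_s (P.src e₀)
  obtain ⟨m, hm⟩ := P.exists_isWalk_to_t (P.tgt e₀)
  have hπ : P.IsWalk P.s (l ++ e₀ :: m) P.t := hl.append ⟨rfl, hm⟩
  obtain ⟨w, -, -, hw, -⟩ := exists_winding (G := P.toPlaneGraph) _
    (hπ.isCirculation_count_sub P.dom_isPath.1)
  have h1 := hD.isCirculation fun F => (w F : ℝ)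
  rw [sum_edgeIndicator_mul] at h1
  have hdom : ∀ e ∈ D, P.dom.count e = 0 := by
    intro e he
    refine List.count_eq_zero_of_not_mem fun hed => ?_
    obtain ⟨e', he', hee'⟩ := hD.exists_next he
    obtain ⟨α, hα, hαe⟩ := (hDf e' he').1
    rw [hee', P.mem_dom.1 hed] at hαe
    cases hαe
  have h2 : ∑ e ∈ D, ((l ++ e₀ :: m).count e : ℝ) = 0 := by
    rw [← h1]
    refine Finset.sum_congr rfl fun e he => ?_
    have := hw e
    simp only [hdom e he, Nat.cast_zero, sub_zero] at this
    exact_mod_cast this.symm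
  have h3 := Finset.single_le_sum (f := fun e => ((l ++ e₀ :: m).count e : ℝ))
    (fun e _ => by positivity) he₀
  rw [h2] at h3
  have h4 : 0 < (l ++ e₀ :: m).count e₀ := List.count_pos_iff.2 (by simp)
  have h5 : (0 : ℝ) < (l ++ e₀ :: m).count e₀ := by exact_mod_cast h4
  exact absurd h3 h5.not_ge

/-- The path `l` runs along the upper boundary of the region formed by the atomic 2-cells in `S`
and the lower boundary `cod` of the pasting scheme. -/
def IsFrontier [DecidableEq E] [DecidableEq P.TwoCell] (S : Finset P.TwoCell) (l : List E) : Prop :=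
  ∀ e, (l.count e : ℤ) = (if P.rightFace e ∈ S.insertNone then 1 else 0) -
    if P.leftFace e ∈ S.map Function.Embedding.some then 1 else 0

theorem exists_presentation_of_isFrontier [DecidableEq E] [DecidableEq P.TwoCell] (n : ℕ) :
    ∀ (S : Finset P.TwoCell) (l : List E), S.card = n → P.IsWalk P.s l P.t → P.IsFrontier S l →
    ∃ (α : Fin n → P.TwoCell) (p q : Fin n → List E), Function.Injective α ∧
      (∀ β, β ∈ S ↔ ∃ i, α i = β) ∧
      (∀ i, P.IsWalk P.s (p i) (P.cellSource (α i)) ∧ P.IsWalk (P.cellTarget (α i)) (q i) P.t) ∧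
      (∀ i j : Fin n, (j : ℕ) = i + 1 →
        p i ++ P.cellCod (α i) ++ q i = p j ++ P.cellDom (α j) ++ q j) ∧
      (∀ i : Fin n, (i : ℕ) = 0 → p i ++ P.cellDom (α i) ++ q i = l) ∧
      (∀ i : Fin n, (i : ℕ) + 1 = n → p i ++ P.cellCod (α i) ++ q i = P.cod) ∧
      (n = 0 → l = P.cod) := by
  induction n with
  | zero =>
    intro S l hS hl hlS
    obtain rfl := Finset.card_eq_zero.1 hS
    refine ⟨Fin.elim0, Fin.elim0, Fin.elim0, fun i => i.elim0, fun β => by simp, fun i => i.elim0,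
      fun i => i.elim0, fun i => i.elim0, fun i => i.elim0, fun _ => ?_⟩
    have h : ∀ e, e ∈ l ↔ e ∈ P.cod := fun e => by
      rw [P.mem_cod, ← List.count_pos_iff, ← Int.natCast_pos, hlS e]
      rcases h : P.rightFace e with _ | β <;> simp
    exact (P.isPath_of_isWalk hl).eq_of_subset P.cod_isPath (fun e => (h e).1) fun e => (h e).2
  | succ n ih =>
    intro S l hS hl hlS
    obtain ⟨α₀, hα₀, htop⟩ := P.exists_uppermost S (Finset.card_pos.1 (by omega))
    obtain ⟨p₀, q₀, rfl, hp₀, hq₀⟩ := (P.cellDom_isPath α₀).1.exists_eq_append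
      (P.cellDom_ne_nil α₀) (P.isPath_of_isWalk hl) fun e he => by
        rw [← List.count_pos_iff, ← Int.natCast_pos, hlS e, P.mem_cellDom.1 he,
          if_pos (by simpa using hα₀), if_neg]
        · simp
        · intro h
          obtain ⟨β, hβ, h'⟩ := Finset.mem_map.1 h
          exact htop e he β hβ h'.symm
    have hl' : P.IsWalk P.s (p₀ ++ P.cellCod α₀ ++ q₀) P.t :=
      (hp₀.append (P.cellCod_isPath α₀).1).append hq₀
    have hcount : ∀ {m : List E} {F : Option P.TwoCell} {e : E}, m.Nodup → (e ∈ m ↔ F = some α₀) →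
        (m.count e : ℤ) = if F = some α₀ then 1 else 0 := by
      intro m F e hm h
      split_ifs with hF
      · rw [List.count_eq_one_of_mem hm (h.2 hF)]; rfl
      · rw [List.count_eq_zero_of_not_mem fun he => hF (h.1 he)]; rfl
    obtain ⟨α, p, q, hinj, hmem, hpq, hcons, hfirst, hlast, hzero⟩ := ih (S.erase α₀) _
      (by rw [Finset.card_erase_of_mem hα₀, hS]; rfl) hl' (by
        intro e
        have h1 := hlS e
        have h2 := hcount (e := e) (P.cellDom_isPath α₀).nodup P.mem_cellDom
        have h3 := hcount (e := e) (P.cellCod_isPath α₀).nodup P.mem_cellCod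
        simp only [List.count_append, Nat.cast_add] at h1 ⊢
        have h4 : ((if P.rightFace e ∈ (S.erase α₀).insertNone then 1 else 0 : ℤ)) =
            (if P.rightFace e ∈ S.insertNone then 1 else 0) -
              if P.rightFace e = some α₀ then 1 else 0 := by
          rcases h : P.rightFace e with _ | β
          · simp
          · by_cases hβ : β = α₀ <;> simp [hβ, hα₀]
        have h5 : ((if P.leftFace e ∈ (S.erase α₀).map Function.Embedding.some then 1 else 0 : ℤ)) =
            (if P.leftFace e ∈ S.map Function.Embedding.some then 1 else 0) -
              if P.leftFace e = some α₀ then 1 else 0 := by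
          rcases h : P.leftFace e with _ | β
          · simp
          · by_cases hβ : β = α₀ <;> simp [hβ, hα₀]
        rw [h4, h5]
        linarith)
    refine ⟨Fin.cons α₀ α, Fin.cons p₀ p, Fin.cons q₀ q, ?_, fun β => ?_, fun i => ?_,
      fun i j hij => ?_, fun i hi => ?_, fun i hi => ?_, fun h => by omega⟩
    · rw [Fin.cons_injective_iff]
      refine ⟨?_, hinj⟩
      rintro ⟨i, hi⟩
      exact Finset.notMem_erase α₀ S ((hmem α₀).2 ⟨i, hi⟩)
    · rw [Fin.exists_fin_succ]
      simp only [Fin.cons_zero, Fin.cons_succ]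
      rw [← hmem, Finset.mem_erase]
      by_cases h : α₀ = β
      · simp [← h, hα₀]
      · simp [h, Ne.symm h]
    · refine Fin.cases ?_ (fun i => ?_) i
      · exact ⟨hp₀, hq₀⟩
      · simpa using hpq i
    · induction j using Fin.cases with
      | zero => simp at hij
      | succ j =>
        induction i using Fin.cases with
        | zero =>
          simp only [Fin.cons_zero, Fin.cons_succ]
          exact (hfirst j (by simpa using hij)).symm
        | succ i =>
          simp only [Fin.cons_succ]
          exact hcons i j (by simpa using hij)
    · obtain rfl : i = 0 := Fin.ext hi
      simp
    · induction i using Fin.cases with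
      | zero =>
        simp only [Fin.cons_zero]
        exact hzero (by simpa using hi.symm)
      | succ i =>
        simp only [Fin.cons_succ]
        exact hlast i (by simpa using hi)

end PastingScheme

end PastingSchemeTopology

theorem mainTheorem9 {V E : Type*} (P : PastingScheme V E) :
    ∃ (n : ℕ) (α : Fin n ≃ P.TwoCell) (p q : Fin n → List E),
      (∀ i, P.IsPath P.s (p i) (P.cellSource (α i)) ∧ P.IsPath (P.cellTarget (α i)) (q i) P.t) ∧
      (∀ i j : Fin n, (j : ℕ) = i + 1 →
        p i ++ P.cellCod (α i) ++ q i = p j ++ P.cellDom (α j) ++ q j) ∧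
      (∀ i : Fin n, (i : ℕ) = 0 → p i ++ P.cellDom (α i) ++ q i = P.dom) ∧
      (∀ i : Fin n, (i : ℕ) + 1 = n → p i ++ P.cellCod (α i) ++ q i = P.cod) := by
  classical
  have := P.finite_twoCell
  have := Fintype.ofFinite P.TwoCell
  obtain ⟨α, p, q, hinj, hmem, hpq, hcons, hfirst, hlast, -⟩ :=
    P.exists_presentation_of_isFrontier _ Finset.univ P.dom rfl P.dom_isPath.1 (by
      intro e
      have h1 : P.rightFace e ∈ (Finset.univ : Finset P.TwoCell).insertNone := by
        rcases h : P.rightFace e with _ | β <;> simp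
      rw [if_pos h1]
      rcases h : P.leftFace e with _ | β
      · rw [List.count_eq_one_of_mem P.dom_isPath.nodup (P.mem_dom.2 h)]
        simp
      · rw [List.count_eq_zero_of_not_mem fun he => by rw [P.mem_dom.1 he] at h; cases h]
        simp)
  exact ⟨_, Equiv.ofBijective α ⟨hinj, fun β => (hmem β).1 (Finset.mem_univ β)⟩, p, q,
    fun i => ⟨P.isPath_of_isWalk (hpq i).1, P.isPath_of_isWalk (hpq i).2⟩, hcons, hfirst, hlast⟩
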